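/- Let $n,d,m$ be positive integers and $\mathbb S=\{1,\dots,m\}$. On a probability space let $B$ be a $d$-dimensional Brownian motion and $r$ a right-continuous Markov chain on $\mathbb S$ with $r(0)=\ell$, independent of $B$, with generator $\Gamma=(\gamma_{ij})$ (so $\gamma_{ij}\ge 0$ for $i\ne j$, $\sum_j\gamma_{ij}=0$, and the transition matrices are $e^{t\Gamma}$). Assume that $\Gamma$ is irreducible, i.e. the system $\pi\Gamma=0$, $\sum_i\pi_i=1$ has a unique solution $\pi$, and $\pi_i>0$ for all $i$. Let $x_0\in\mathbb R^n$, and let $f(\cdot,i):\mathbb R^n\to\mathbb R^n$, $g(\cdot,i):\mathbb R^n\to\mathbb R^{n\times d}$, $i\in\mathbb S$, be locally Lipschitz. Write $|A|=\sqrt{\operatorname{trace}(A^TA)}$. Suppose that $f(0,i)=0$ and $g(0,i)=0$ for all $i$, and that there are $\rho>0$, a symmetric positive definite $Q\in\mathbb R^{n\times n}$ and $\beta=(\beta_1,\dots,\beta_m)\in\mathbb R^m$ such that, for all $x\in\mathbb R^n$ and $i\in\mathbb S$, $$(x^TQx)\,\psi(x,i)-(2-\rho)|x^TQg(x,i)|^2\le\beta_i(x^TQx)^2,\qquad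 \psi(x,i)=2x^TQf(x,i)+\operatorname{trace}\big(g(x,i)^TQg(x,i)\big),$$ and that $\sum_i\pi_i\beta_i<0$. For $p>0$ put $\eta_{p,\beta}=-\max\{\operatorname{Re}\nu:\nu\text{ an eigenvalue of }\Gamma+\tfrac p2\operatorname{diag}(\beta)\}$. Let $p^*_\beta=+\infty$ if $\max_i\beta_i\le 0$, and let $p^*_\beta$ be any number in $\big(0,\min_{i:\beta_i>0}(-2\gamma_{ii}/\beta_i)\big)$ if $\max_i\beta_i>0$. For each $i$ let $\varphi_i:[0,\infty)\to[0,\infty)$ be continuous, strictly increasing and unbounded with $$\sup_{|x|\vee|y|\le u,\ x\ne y}\Big(\frac{|f(x,i)-f(y,i)|}{|x-y|}\vee\frac{|g(x,i)-g(y,i)|^2}{|x-y|^2}\Big)\le\varphi_i(u)\qquad\text{for all }u\ge 1;$$ if this supremum is bounded in $u$, one may instead take for $\varphi_i$ a constant $C$ that bounds it, with the convention $\varphi_i^{-1}\equiv+\infty$ on $[C,\infty)$. Let $h:(0,1]\to[\max_i\varphi_i(|x_0|\vee1),\infty)$ be strictly decreasing with $h(1)\ge\max_i\{|f(0,i)|\vee|g(0,i)|^2\}$,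 $\lim_{\Delta\to0}h(\Delta)=\infty$, and $\Delta^{1/2-\theta}h(\Delta)\le K$ for all $\Delta\in(0,1]$, for some $\theta\in(0,\tfrac12)$ and $K>0$. For $\Delta\in(0,1]$ let $\pi^i_\Delta(x)=\big(|x|\wedge\varphi_i^{-1}(h(\Delta))\big)\,x/|x|$, with $\pi^i_\Delta(0)=0$, and define, with $r_k=r(k\Delta)$, the scheme $$\tilde Z_0=x_0,\qquad Z_k=\pi^{r_k}_\Delta(\tilde Z_k),\qquad \tilde Z_{k+1}=Z_k+f(Z_k,r_k)\Delta+g(Z_k,r_k)\big(B((k+1)\Delta)-B(k\Delta)\big),\qquad k\ge 0.$$ Then for every $p\in(0,p^*_\beta)\cap(0,\rho]$ and every $\varrho\in(0,\eta_{p,\beta})$ there is $\Delta^{**}\in(0,1]$ such that, for all $\Delta\in(0,\Delta^{**}]$, $$\limsup_{k\to\infty}\frac{\log\mathbb E|Z_k|^p}{k\Delta}\le-(\eta_{p,\beta}-\varrho)<0\qquad\text{and}\qquad\limsup_{k\to\infty}\frac{\log|Z_k|}{k\Delta}\le-\frac{\eta_{p,\beta}-\varrho}{p}\quad\text{almost surely},$$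 where $\log 0=-\infty$. -/

import Mathlib

open MeasureTheory ProbabilityTheory Filter Topology
open scoped NNReal ENNReal Matrix

noncomputable section

namespace SwitchingEM

/-- The trace norm `|A| = √(trace (Aᵀ A))` of a real matrix. -/
def traceNorm {n d : ℕ} (A : Matrix (Fin n) (Fin d) ℝ) : ℝ :=
  √((Aᵀ * A).trace)

/-- `Γ = (γ_ij)` is the generator of a Markov chain with finitely many states: `γ_ij ≥ 0` for
`i ≠ j`, and every row sums to zero. -/
structure IsGenerator {m : ℕ} (Γ : Matrix (Fin m) (Fin m) ℝ) : Prop where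
  nonneg : ∀ i j, i ≠ j → 0 ≤ Γ i j
  row_sum : ∀ i, ∑ j, Γ i j = 0

/-- `π` solves `π Γ = 0`, `∑ π_i = 1`. -/
def IsStationaryVector {m : ℕ} (Γ : Matrix (Fin m) (Fin m) ℝ) (π : Fin m → ℝ) : Prop :=
  π ᵥ* Γ = 0 ∧ ∑ i, π i = 1

/-- Irreducibility: the system `π Γ = 0`, `∑ π_i = 1` has a unique solution, and this solution
has positive entries. -/
def IsIrreducibleGenerator {m : ℕ} (Γ : Matrix (Fin m) (Fin m) ℝ) : Prop :=
  ∃ π : Fin m → ℝ, IsStationaryVector Γ π ∧ (∀ i, 0 < π i) ∧ ∀ π', IsStationaryVector Γ π' → π' = π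

/-- `r` is a right-continuous, time homogeneous Markov chain with generator `Γ`, started at `ℓ`:
its transition matrices are `P(t) = exp(t Γ)`, and its finite-dimensional distributions are
`P(r(t₀) = i₀, …, r(t_N) = i_N) = P(r(t₀) = i₀) P_{i₀ i₁}(t₁ - t₀) ⋯ P_{i_{N-1} i_N}(t_N - t_{N-1})`
for `t₀ ≤ t₁ ≤ … ≤ t_N`. -/
structure IsMarkovChain {Ω : Type*} [MeasurableSpace Ω] (P : Measure Ω) {m : ℕ}
    (Γ : Matrix (Fin m) (Fin m) ℝ) (ℓ : Fin m) (r : ℝ≥0 → Ω → Fin m) : Prop where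
  measurable : ∀ t, Measurable (r t)
  right_continuous : ∀ᵐ ω ∂P, ∀ t : ℝ≥0, ContinuousWithinAt (fun s => r s ω) (Set.Ici t) t
  initial : ∀ᵐ ω ∂P, r 0 ω = ℓ
  finite_dim : ∀ (N : ℕ) (t : Fin (N + 1) → ℝ≥0), Monotone t → ∀ i : Fin (N + 1) → Fin m,
    P.real {ω | ∀ k, r (t k) ω = i k} =
      P.real {ω | r (t 0) ω = i 0} *
        ∏ k : Fin N, NormedSpace.exp (((t k.succ : ℝ) - (t k.castSucc : ℝ)) • Γ)
          (i k.castSucc) (i k.succ)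

/-- `B` is a `d`-dimensional Brownian motion: its coordinates are independent real Brownian
motions started at `0`. -/
structure IsBrownianMotion {Ω : Type*} [MeasurableSpace Ω] (P : Measure Ω) {d : ℕ}
    (B : ℝ≥0 → Ω → EuclideanSpace ℝ (Fin d)) : Prop where
  measurable : ∀ t, Measurable (B t)
  coord : ∀ a : Fin d, IsBrownianReal (fun t ω => B t ω a) P
  indep : iIndepFun (fun (a : Fin d) (ω : Ω) (t : ℝ≥0) => B t ω a) P

/-- Local Lipschitz continuity of the coefficients, uniformly in the state `i`. -/
def IsLocallyLipschitz {n d m : ℕ}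
    (f : EuclideanSpace ℝ (Fin n) → Fin m → EuclideanSpace ℝ (Fin n))
    (g : EuclideanSpace ℝ (Fin n) → Fin m → Matrix (Fin n) (Fin d) ℝ) : Prop :=
  ∀ N : ℝ, 0 < N → ∃ C : ℝ, 0 < C ∧ ∀ x y : EuclideanSpace ℝ (Fin n), max ‖x‖ ‖y‖ ≤ N →
    ∀ i, max ‖f x i - f y i‖ (traceNorm (g x i - g y i)) ≤ C * ‖x - y‖

/-- The quadratic form `xᵀ Q x`. -/
def quad {n : ℕ} (Q : Matrix (Fin n) (Fin n) ℝ) (x : EuclideanSpace ℝ (Fin n)) : ℝ :=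
  x.ofLp ⬝ᵥ (Q *ᵥ x.ofLp)

/-- `ψ(x, i) = 2 xᵀ Q f(x, i) + trace (g(x, i)ᵀ Q g(x, i))`. -/
def psi {n d m : ℕ} (f : EuclideanSpace ℝ (Fin n) → Fin m → EuclideanSpace ℝ (Fin n))
    (g : EuclideanSpace ℝ (Fin n) → Fin m → Matrix (Fin n) (Fin d) ℝ)
    (Q : Matrix (Fin n) (Fin n) ℝ) (x : EuclideanSpace ℝ (Fin n)) (i : Fin m) : ℝ :=
  2 * (x.ofLp ⬝ᵥ (Q *ᵥ (f x i).ofLp)) + ((g x i)ᵀ * Q * g x i).trace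

/-- The assumption on the coefficients under which the trivial solution is stable:
`f(0, i) = 0`, `g(0, i) = 0`, `Q` is symmetric positive definite, `ρ > 0`, and
`(xᵀQx) ψ(x, i) - (2 - ρ) |xᵀ Q g(x, i)|² ≤ β_i (xᵀQx)²`. -/
structure StabilityAssumption {n d m : ℕ}
    (f : EuclideanSpace ℝ (Fin n) → Fin m → EuclideanSpace ℝ (Fin n))
    (g : EuclideanSpace ℝ (Fin n) → Fin m → Matrix (Fin n) (Fin d) ℝ)
    (Q : Matrix (Fin n) (Fin n) ℝ) (β : Fin m → ℝ) (ρ : ℝ) : Prop where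
  f_zero : ∀ i, f 0 i = 0
  g_zero : ∀ i, g 0 i = 0
  Q_posDef : Q.PosDef
  rho_pos : 0 < ρ
  bound : ∀ x i, quad Q x * psi f g Q x i
      - (2 - ρ) * ‖WithLp.toLp 2 (x.ofLp ᵥ* (Q * g x i))‖ ^ 2 ≤ β i * quad Q x ^ 2

/-- `η_{p,u} = - max {Re ν : ν an eigenvalue of Γ + (p/2) diag(u)}`. -/
def eta {m : ℕ} (Γ : Matrix (Fin m) (Fin m) ℝ) (p : ℝ) (u : Fin m → ℝ) : ℝ :=
  - sSup (Complex.re ''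
      spectrum ℂ ((Γ + (p / 2) • Matrix.diagonal u).map (fun a : ℝ => (a : ℂ))))

/-- The admissible values of the critical exponent `p*_u`: it is `+∞` if `max u_i ≤ 0`, and it
lies in the interval `(0, min {-2 γ_ii / u_i : u_i > 0})` if `max u_i > 0`. -/
def IsCriticalExponent {m : ℕ} (Γ : Matrix (Fin m) (Fin m) ℝ) (u : Fin m → ℝ)
    (pstar : EReal) : Prop :=
  ((∀ i, u i ≤ 0) → pstar = ⊤) ∧
    ((∃ i, 0 < u i) → 0 < pstar ∧
      ∀ i, 0 < u i → pstar < ((-2 * Γ i i / u i : ℝ) : EReal))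

/-- The functions `φ_i : [0, ∞) → [0, ∞)` that control the Lipschitz constants of the coefficients
on balls. Each `φ_i` is continuous, strictly increasing and unbounded; for a state in which the
coefficients are globally Lipschitz, `φ_i` may also be a constant (then that state is not
truncated, see `truncRadius`). -/
structure IsLipschitzControl {n d m : ℕ}
    (f : EuclideanSpace ℝ (Fin n) → Fin m → EuclideanSpace ℝ (Fin n))
    (g : EuclideanSpace ℝ (Fin n) → Fin m → Matrix (Fin n) (Fin d) ℝ)
    (φ : Fin m → ℝ → ℝ) : Prop where
  nonneg : ∀ i, ∀ u, 0 ≤ u → 0 ≤ φ i u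
  shape : ∀ i,
    (StrictMonoOn (φ i) (Set.Ici 0) ∧ ContinuousOn (φ i) (Set.Ici 0) ∧
      Tendsto (φ i) atTop atTop) ∨
    (∃ C : ℝ, ∀ u, 0 ≤ u → φ i u = C)
  bound : ∀ i, ∀ u, 1 ≤ u → ∀ x y : EuclideanSpace ℝ (Fin n), max ‖x‖ ‖y‖ ≤ u → x ≠ y →
    max (‖f x i - f y i‖ / ‖x - y‖) (traceNorm (g x i - g y i) ^ 2 / ‖x - y‖ ^ 2) ≤ φ i u

/-- The function `h : (0, 1] → [max_i φ_i(|x₀| ∨ 1), ∞)` that fixes the truncation level in terms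
of the stepsize. -/
structure IsTruncationLevel {n d m : ℕ}
    (f : EuclideanSpace ℝ (Fin n) → Fin m → EuclideanSpace ℝ (Fin n))
    (g : EuclideanSpace ℝ (Fin n) → Fin m → Matrix (Fin n) (Fin d) ℝ)
    (φ : Fin m → ℝ → ℝ) (x₀ : EuclideanSpace ℝ (Fin n)) (h : ℝ → ℝ) : Prop where
  range : ∀ Δ ∈ Set.Ioc (0 : ℝ) 1, ∀ i, φ i (max ‖x₀‖ 1) ≤ h Δ
  strictAnti : StrictAntiOn h (Set.Ioc 0 1)
  at_one : ∀ i, max ‖f 0 i‖ (traceNorm (g 0 i) ^ 2) ≤ h 1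
  tendsto : Tendsto h (𝓝[>] 0) atTop
  rate : ∃ θ : ℝ, 0 < θ ∧ θ < 1 / 2 ∧ ∃ K : ℝ, 0 < K ∧
    ∀ Δ ∈ Set.Ioc (0 : ℝ) 1, Δ ^ (1 / 2 - θ) * h Δ ≤ K

/-- The inverse function `φ⁻¹(v) ∈ [0, ∞]`, written as `sup {u ≥ 0 : φ(u) ≤ v}`. For `φ`
continuous, strictly increasing and unbounded and `v ≥ φ(0)` it is the usual inverse; for a
constant `φ = C ≤ v` it is `+∞`. -/
def truncRadius (φ : ℝ → ℝ) (v : ℝ) : ℝ≥0∞ :=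
  ⨆ (u : ℝ≥0) (_ : φ u ≤ v), (u : ℝ≥0∞)

/-- The truncation map `x ↦ (|x| ∧ R) x / |x|`, with `x / |x| = 0` for `x = 0`. -/
def trunc {n : ℕ} (R : ℝ≥0∞) (x : EuclideanSpace ℝ (Fin n)) : EuclideanSpace ℝ (Fin n) :=
  (min ‖x‖ₑ R).toReal • (‖x‖⁻¹ • x)

/-- The untruncated values `Z̃_k` of the scheme, for given values `r_k` of the chain and increments
`b_k` of the Brownian motion: `Z̃_0 = x₀` and, with `Z_k` the truncation of `Z̃_k` to the ball of
radius `φ_{r_k}⁻¹(h(Δ))`, `Z̃_{k+1} = Z_k + f(Z_k, r_k) Δ + g(Z_k, r_k) b_k`. -/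
def preScheme {n d m : ℕ}
    (f : EuclideanSpace ℝ (Fin n) → Fin m → EuclideanSpace ℝ (Fin n))
    (g : EuclideanSpace ℝ (Fin n) → Fin m → Matrix (Fin n) (Fin d) ℝ)
    (φ : Fin m → ℝ → ℝ) (h : ℝ → ℝ) (x₀ : EuclideanSpace ℝ (Fin n)) (Δ : ℝ)
    (r : ℕ → Fin m) (b : ℕ → EuclideanSpace ℝ (Fin d)) : ℕ → EuclideanSpace ℝ (Fin n)
  | 0 => x₀
  | k + 1 =>
    let Z := trunc (truncRadius (φ (r k)) (h Δ)) (preScheme f g φ h x₀ Δ r b k)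
    Z + Δ • f Z (r k) + WithLp.toLp 2 (g Z (r k) *ᵥ (b k).ofLp)

/-- The numerical solution `Z_k` with stepsize `Δ`, driven by `r_k = r(kΔ)` and the increments
`B((k+1)Δ) - B(kΔ)`. -/
def scheme {Ω : Type*} {n d m : ℕ}
    (f : EuclideanSpace ℝ (Fin n) → Fin m → EuclideanSpace ℝ (Fin n))
    (g : EuclideanSpace ℝ (Fin n) → Fin m → Matrix (Fin n) (Fin d) ℝ)
    (φ : Fin m → ℝ → ℝ) (h : ℝ → ℝ) (x₀ : EuclideanSpace ℝ (Fin n))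
    (r : ℝ≥0 → Ω → Fin m) (B : ℝ≥0 → Ω → EuclideanSpace ℝ (Fin d))
    (Δ : ℝ) (k : ℕ) (ω : Ω) : EuclideanSpace ℝ (Fin n) :=
  trunc (truncRadius (φ (r (k * Δ.toNNReal) ω)) (h Δ))
    (preScheme f g φ h x₀ Δ (fun j => r (j * Δ.toNNReal) ω)
      (fun j => B ((j + 1) * Δ.toNNReal) ω - B (j * Δ.toNNReal) ω) k)

end SwitchingEM

end

open SwitchingEM

/-!
Write `Q = RᵀR` and take `V(x) = |Rx|^p` as a Lyapunov function; truncation is radial, so it does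
not increase `V`. In one Euler-Maruyama step from `x` in state `i`, expand `(1 + ξ)^{p/2}` to second
order, where `1 + ξ` is the factor by which `|Rx|²` changes. For `p ≤ ρ` the stability assumption
bounds the first order term in `Δ` of the expectation by `(p/2) β_i Δ`, and `Δ^{1/2-θ} h(Δ) ≤ K`
makes the remainder `O(Δ^{1+2θ})`, so that `E V` grows at most by the factor
`exp((p/2) β_i Δ + C Δ^{1+2θ})`. As the chain is independent of the noise, `E V(Z_k)` is at most
`V(x₀)` times the expected product of these factors along the chain.

The matrix `Γ + (p/2) diag(β)` has nonnegative off-diagonal entries and spectral abscissa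
`-η_{p,β}`, so by Perron-Frobenius theory for every `κ < η_{p,β}` there is a positive vector `ζ`
with `(Γ + (p/2) diag(β)) ζ < -κ ζ`. For small `Δ`, weighting the product with `ζ(r_k)` makes it
contract in expectation by `exp(-κΔ)` per step, which gives the decay of the moments. Since this
holds for rates slightly larger than the desired one, `∑ exp(κkΔ) E|Z_k|^p` converges, which gives
the almost sure rate.
-/

noncomputable section

namespace SwitchingEM

section Metzler

attribute [local instance] Matrix.linftyOpNormedRing Matrix.linftyOpNormedAlgebra

section BanachAlgebra

variable {A : Type*} [NormedRing A] [CompleteSpace A] [NormedAlgebra ℂ A]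

theorem summable_pow_of_spectralRadius_lt_one {a : A} (ha : spectralRadius ℂ a < 1) :
    Summable fun k : ℕ => a ^ k := by
  obtain ⟨q, hq, hq1⟩ := ENNReal.lt_iff_exists_nnreal_btwn.1 ha
  refine summable_of_isBigO_nat (summable_geometric_of_lt_one q.2 (by exact_mod_cast hq1)) ?_
  have gelfand := (spectrum.pow_nnnorm_pow_one_div_tendsto_nhds_spectralRadius a).eventually
    (gt_mem_nhds hq)
  refine Asymptotics.IsBigO.of_bound 1 ?_
  filter_upwards [gelfand, eventually_ne_atTop 0] with k hk hk0
  have h : ‖a ^ k‖₊ ≤ q ^ k := by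
    rw [one_div, ENNReal.rpow_inv_lt_iff (by positivity), ENNReal.rpow_natCast] at hk
    exact_mod_cast hk.le
  simpa using (show ‖a ^ k‖ ≤ (q : ℝ) ^ k from mod_cast h)

theorem summable_pow_inv_smul_add_algebraMap [Nontrivial A] {a : A} {c : ℝ} (hc : 0 < c)
    (h : ∀ z ∈ spectrum ℂ a, ‖z + c‖ < c) :
    Summable fun k : ℕ => ((c : ℂ)⁻¹ • (a + algebraMap ℂ A c)) ^ k := by
  have hcC : (c : ℂ) ≠ 0 := mod_cast hc.ne'
  refine summable_pow_of_spectralRadius_lt_one ?_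
  rw [← ENNReal.coe_one]
  refine spectrum.spectralRadius_lt_of_forall_lt _ fun z hz => ?_
  have hmem : (c : ℂ) * z - c ∈ spectrum ℂ a := by
    rw [← spectrum.add_mem_add_iff (s := (c : ℂ)), sub_add_cancel, add_comm]
    have h := spectrum.smul_mem_smul_iff (r := Units.mk0 (c : ℂ) hcC).2 hz
    simpa only [Units.smul_def, Units.val_mk0, smul_smul, mul_inv_cancel₀ hcC, one_smul,
      smul_eq_mul] using h
  have hlt := h _ hmem
  rw [sub_add_cancel, norm_mul, Complex.norm_of_nonneg hc.le] at hlt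
  exact mod_cast (mul_lt_iff_lt_one_right hc).1 hlt

end BanachAlgebra

theorem exists_norm_add_lt {S : Set ℂ} (hS : S.Finite) (h : ∀ z ∈ S, z.re < 0) (c₀ : ℝ) :
    ∃ c : ℝ, 0 < c ∧ c₀ ≤ c ∧ ∀ z ∈ S, ‖z + c‖ < c := by
  have key : ∀ z ∈ S, ∀ᶠ c : ℝ in atTop, ‖z + c‖ < c := by
    intro z hz
    filter_upwards [eventually_gt_atTop 0, eventually_gt_atTop (‖z‖ ^ 2 / (-2 * z.re))]
      with c hc0 hc
    rw [div_lt_iff₀ (by linarith [h z hz])] at hc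
    refine lt_of_pow_lt_pow_left₀ 2 hc0.le ?_
    rw [← Complex.normSq_eq_norm_sq] at hc ⊢
    simp only [Complex.normSq_apply, Complex.add_re, Complex.add_im, Complex.ofReal_re,
      Complex.ofReal_im] at hc ⊢
    linarith
  obtain ⟨c, hc, hc0, hcc₀⟩ := (((eventually_all_finite hS).2 key).and
    ((eventually_gt_atTop 0).and (eventually_ge_atTop c₀))).exists
  exact ⟨c, hc0, hcc₀, hc⟩

variable {ι : Type*} [Fintype ι] [DecidableEq ι]

theorem exists_pos_mulVec_lt_of_summable_pow {N : Matrix ι ι ℝ} (hN : ∀ i j, 0 ≤ N i j)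
    (hsum : Summable fun k : ℕ => N ^ k) :
    ∃ ζ : ι → ℝ, (∀ i, 0 < ζ i) ∧ ∀ i, (N *ᵥ ζ) i < ζ i := by
  set ζ : ι → ℝ := (∑' k, N ^ k) *ᵥ 1
  have neumann : N *ᵥ ζ = ζ - 1 := by
    have h := congrArg (· *ᵥ (1 : ι → ℝ)) hsum.one_sub_mul_tsum_pow
    simp only [sub_mul, one_mul, Matrix.sub_mulVec, ← Matrix.mulVec_mulVec,
      Matrix.one_mulVec] at h
    rw [← h, sub_sub_cancel]
  have entry_nonneg : ∀ i j, 0 ≤ (∑' k, N ^ k) i j := fun i j =>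
    (hsum.hasSum.map (Matrix.entryAddMonoidHom ℝ i j) (continuous_apply_apply i j)).nonneg
      fun k => Matrix.pow_apply_nonneg hN k i j
  have hζ0 : ∀ i, 0 ≤ ζ i := fun i =>
    Finset.sum_nonneg fun j _ => mul_nonneg (entry_nonneg i j) zero_le_one
  have hNζ : ∀ i, (N *ᵥ ζ) i = ζ i - 1 := congrFun neumann
  have hNζ0 : ∀ i, 0 ≤ (N *ᵥ ζ) i := fun i =>
    Finset.sum_nonneg fun j _ => mul_nonneg (hN i j) (hζ0 j)
  exact ⟨ζ, fun i => by linarith [hNζ i, hNζ0 i], fun i => by linarith [hNζ i]⟩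

/- For large `c` the matrix `N = c⁻¹ (A + c)` is entrywise nonnegative and has spectral radius
less than one, so its Neumann series applied to `(1, …, 1)` provides the vector. -/
theorem exists_pos_mulVec_neg {A : Matrix ι ι ℝ} (hA : ∀ i j, i ≠ j → 0 ≤ A i j)
    (hspec : ∀ z ∈ spectrum ℂ (A.map ((↑) : ℝ → ℂ)), z.re < 0) :
    ∃ ζ : ι → ℝ, (∀ i, 0 < ζ i) ∧ ∀ i, (A *ᵥ ζ) i < 0 := by
  cases isEmpty_or_nonempty ι
  · exact ⟨1, isEmptyElim, isEmptyElim⟩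
  obtain ⟨c, hc0, hc, hcspec⟩ :=
    exists_norm_add_lt (Matrix.finite_spectrum _) hspec (∑ i, |A i i|)
  set N : Matrix ι ι ℝ := c⁻¹ • (A + algebraMap ℝ _ c) with hN
  have hN0 : ∀ i j, 0 ≤ N i j := by
    intro i j
    refine mul_nonneg (inv_nonneg.2 hc0.le) ?_
    rcases eq_or_ne i j with rfl | hij
    · have hi : |A i i| ≤ c := (Finset.single_le_sum (f := fun i => |A i i|)
        (fun _ _ => abs_nonneg _) (Finset.mem_univ i)).trans hc
      simpa [Matrix.algebraMap_matrix_apply] using neg_le_iff_add_nonneg.1 (abs_le.1 hi).1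
    · simpa [Matrix.algebraMap_matrix_apply, hij] using hA i j hij
  have hNC : N.map ((↑) : ℝ → ℂ) = (c : ℂ)⁻¹ • (A.map (↑) + algebraMap ℂ _ (c : ℂ)) := by
    ext i j
    by_cases hij : i = j <;> simp [hN, Matrix.algebraMap_matrix_apply, hij, mul_add]
  have hsum : Summable fun k : ℕ => N ^ k := by
    have h := (summable_pow_inv_smul_add_algebraMap hc0 hcspec).map
      (Complex.reAddGroupHom.mapMatrix (m := ι) (n := ι))
      (continuous_id.matrix_map Complex.continuous_re)
    rw [← hNC] at h
    refine h.congr fun k => ?_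
    ext i j
    have hpow : (N.map ((↑) : ℝ → ℂ)) ^ k = (N ^ k).map (↑) :=
      (map_pow Complex.ofRealHom.mapMatrix N k).symm
    simp [hpow]
  obtain ⟨ζ, hζ, hlt⟩ := exists_pos_mulVec_lt_of_summable_pow hN0 hsum
  refine ⟨ζ, hζ, fun i => ?_⟩
  have hscale : c * (N *ᵥ ζ) i = (A *ᵥ ζ) i + c * ζ i := by
    rw [hN, Matrix.smul_mulVec, Matrix.add_mulVec, Algebra.algebraMap_eq_smul_one,
      Matrix.smul_mulVec, Matrix.one_mulVec]
    simp [hc0.ne']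
  linarith [mul_lt_mul_of_pos_left (hlt i) hc0]

theorem exists_pos_mulVec_lt_mul {A : Matrix ι ι ℝ} (hA : ∀ i j, i ≠ j → 0 ≤ A i j) {lam : ℝ}
    (hspec : ∀ z ∈ spectrum ℂ (A.map ((↑) : ℝ → ℂ)), z.re < lam) :
    ∃ ζ : ι → ℝ, (∀ i, 0 < ζ i) ∧ ∀ i, (A *ᵥ ζ) i < lam * ζ i := by
  have hmap : (A - algebraMap ℝ _ lam).map ((↑) : ℝ → ℂ) =
      A.map (↑) - algebraMap ℂ _ (lam : ℂ) := by
    ext i j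
    by_cases hij : i = j <;> simp [Matrix.algebraMap_matrix_apply, hij]
  obtain ⟨ζ, hζ, hlt⟩ := exists_pos_mulVec_neg (A := A - algebraMap ℝ _ lam)
    (fun i j hij => by simpa [Matrix.algebraMap_matrix_apply, hij] using hA i j hij) <| by
      intro z hz
      rw [hmap, ← spectrum.add_mem_add_iff (s := (lam : ℂ)), add_sub_cancel] at hz
      simpa using hspec _ hz
  refine ⟨ζ, hζ, fun i => ?_⟩
  have h := hlt i
  rw [Matrix.sub_mulVec, Algebra.algebraMap_eq_smul_one, Matrix.smul_mulVec,
    Matrix.one_mulVec] at h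
  exact sub_neg.1 h

theorem hasDerivAt_exp_smul_mulVec_zero (A : Matrix ι ι ℝ) (ζ : ι → ℝ) (i : ι) :
    HasDerivAt (fun t : ℝ => (NormedSpace.exp (t • A) *ᵥ ζ) i) ((A *ᵥ ζ) i) 0 := by
  have hexp : HasDerivAt (fun t : ℝ => NormedSpace.exp (t • A)) A 0 := by
    have h := hasDerivAt_exp_smul_const (𝕂 := ℝ) A (0 : ℝ)
    rwa [zero_smul, NormedSpace.exp_zero, one_mul] at h
  have hentry : ∀ j, HasDerivAt (fun t : ℝ => NormedSpace.exp (t • A) i j) (A i j) 0 := fun j =>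
    (Matrix.entryLinearMap ℝ ℝ i j).toContinuousLinearMap.hasFDerivAt.comp_hasDerivAt 0 hexp
  exact HasDerivAt.fun_sum fun j _ => (hentry j).mul_const (ζ j)

theorem eventually_exp_mul_exp_smul_mulVec_le (A : Matrix ι ι ℝ) {u ζ : ι → ℝ} {lam : ℝ}
    (h : ∀ i, ((A + Matrix.diagonal u) *ᵥ ζ) i < lam * ζ i) (C : ℝ) {κ : ℝ} (hκ : 1 < κ) :
    ∀ᶠ t in 𝓝[>] (0 : ℝ), ∀ i, Real.exp (u i * t + C * t ^ κ) * (NormedSpace.exp (t • A) *ᵥ ζ) i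
      ≤ ζ i * Real.exp (lam * t) := by
  refine eventually_all.2 fun i => ?_
  have hκ0 : (0 : ℝ) ^ κ = 0 := Real.zero_rpow (by linarith)
  have hpow : HasDerivAt (fun t : ℝ => t ^ κ) 0 0 := by
    simpa [Real.zero_rpow (sub_ne_zero.2 hκ.ne')] using
      Real.hasDerivAt_rpow_const (x := 0) (p := κ) (Or.inr hκ.le)
  have hweight : HasDerivAt (fun t : ℝ => Real.exp (u i * t + C * t ^ κ)) (u i) 0 := by
    simpa [hκ0] using! (((hasDerivAt_id (0 : ℝ)).const_mul (u i)).add (hpow.const_mul C)).exp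
  have hrate : HasDerivAt (fun t : ℝ => ζ i * Real.exp (lam * t)) (ζ i * lam) 0 := by
    simpa using! (((hasDerivAt_id (0 : ℝ)).const_mul lam).exp).const_mul (ζ i)
  set D : ℝ → ℝ := fun t => ζ i * Real.exp (lam * t) -
    Real.exp (u i * t + C * t ^ κ) * (NormedSpace.exp (t • A) *ᵥ ζ) i with hD
  have hdiff : HasDerivAt D _ 0 :=
    hrate.sub (hweight.mul (hasDerivAt_exp_smul_mulVec_zero A ζ i))
  have hderiv : 0 < deriv D 0 := by
    rw [hdiff.deriv]
    have hi := h i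
    rw [Matrix.add_mulVec, Pi.add_apply, Matrix.mulVec_diagonal] at hi
    simp only [hκ0, zero_smul, NormedSpace.exp_zero, Matrix.one_mulVec, mul_zero, add_zero,
      Real.exp_zero, one_mul]
    linarith
  have hsign := eventually_nhdsWithin_sign_eq_of_deriv_pos hderiv (by simp [hD, hκ0])
  filter_upwards [nhdsWithin_le_nhds hsign, self_mem_nhdsWithin] with t ht ht0
  rw [sub_zero, sign_pos (Set.mem_Ioi.1 ht0), sign_eq_one_iff] at ht
  exact (sub_pos.1 ht).le

end Metzler

theorem re_lt_of_lt_eta {m : ℕ} {Γ : Matrix (Fin m) (Fin m) ℝ} {p κ : ℝ} {u : Fin m → ℝ}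
    (hκ : κ < eta Γ p u) {z : ℂ}
    (hz : z ∈ spectrum ℂ ((Γ + (p / 2) • Matrix.diagonal u).map ((↑) : ℝ → ℂ))) :
    z.re < -κ := by
  have hle : z.re ≤ sSup _ :=
    le_csSup ((Matrix.finite_spectrum _).image _).bddAbove (Set.mem_image_of_mem Complex.re hz)
  exact hle.trans_lt (lt_neg_of_lt_neg hκ)

theorem exists_eventually_exp_mul_exp_smul_mulVec_le {m : ℕ} {Γ : Matrix (Fin m) (Fin m) ℝ}
    (hΓ : ∀ i j, i ≠ j → 0 ≤ Γ i j) {p κ : ℝ} {u : Fin m → ℝ} (hκ : κ < eta Γ p u) :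
    ∃ ζ : Fin m → ℝ, (∀ i, 0 < ζ i) ∧ ∀ (C : ℝ) {ε : ℝ}, 1 < ε → ∀ᶠ t in 𝓝[>] (0 : ℝ), ∀ i,
      Real.exp (p / 2 * u i * t + C * t ^ ε) * (NormedSpace.exp (t • Γ) *ᵥ ζ) i
        ≤ ζ i * Real.exp (-κ * t) := by
  have hdiag : (p / 2) • Matrix.diagonal u = Matrix.diagonal fun i => p / 2 * u i :=
    (Matrix.diagonal_smul _ _).symm
  obtain ⟨ζ, hζ, hlt⟩ := exists_pos_mulVec_lt_mul
    (A := Γ + (p / 2) • Matrix.diagonal u) (fun i j hij => by simpa [hij] using hΓ i j hij)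
    fun z hz => re_lt_of_lt_eta hκ hz
  exact ⟨ζ, hζ, fun C ε hε => eventually_exp_mul_exp_smul_mulVec_le Γ (hdiag ▸ hlt) C hε⟩

section Binomial

theorem exists_norm_le_pow_mul_one_add_norm_pow {E : Type*} [NormedAddCommGroup E]
    {D : E → ℝ} {S : Set E} {n M : ℕ} {b : ℝ} (hb : 0 ≤ b)
    (hloc : D =O[𝓝 0] fun ξ => ‖ξ‖ ^ n) (hglob : ∀ ξ ∈ S, |D ξ| ≤ b * (1 + ‖ξ‖) ^ M) :
    ∃ C : ℝ, 0 ≤ C ∧ ∀ ξ ∈ S, |D ξ| ≤ C * ‖ξ‖ ^ n * (1 + ‖ξ‖) ^ M := by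
  obtain ⟨C, hC0, hC⟩ := hloc.exists_pos
  obtain ⟨δ, hδ, hball⟩ := Metric.eventually_nhds_iff.1 hC.bound
  refine ⟨C + b / δ ^ n, by positivity, fun ξ hξ => ?_⟩
  rcases lt_or_ge ‖ξ‖ δ with hlt | hge
  · calc |D ξ| ≤ C * ‖ξ‖ ^ n := by simpa using hball (by simpa using hlt)
      _ ≤ (C + b / δ ^ n) * ‖ξ‖ ^ n * 1 := by
        rw [mul_one]; gcongr; exact le_add_of_nonneg_right (by positivity)
      _ ≤ (C + b / δ ^ n) * ‖ξ‖ ^ n * (1 + ‖ξ‖) ^ M := by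
        gcongr; exact one_le_pow₀ (le_add_of_nonneg_right (norm_nonneg ξ))
  · calc |D ξ| ≤ b * (1 + ‖ξ‖) ^ M := hglob ξ hξ
      _ = b / δ ^ n * δ ^ n * (1 + ‖ξ‖) ^ M := by field_simp
      _ ≤ (C + b / δ ^ n) * ‖ξ‖ ^ n * (1 + ‖ξ‖) ^ M := by
        gcongr; exact le_add_of_nonneg_left hC0.le

theorem exists_abs_one_add_rpow_sub_sum_choose_le {s : ℝ} (hs : 0 ≤ s) (n : ℕ) :
    ∃ C : ℝ, 0 ≤ C ∧ ∃ M : ℕ, ∀ ξ : ℝ, -1 ≤ ξ →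
      |(1 + ξ) ^ s - ∑ k ∈ Finset.range n, Ring.choose s k * ξ ^ k|
        ≤ C * |ξ| ^ n * (1 + |ξ|) ^ M := by
  set b : ℝ := 1 + ∑ k ∈ Finset.range n, |Ring.choose s k|
  have hloc : (fun ξ : ℝ => (1 + ξ) ^ s - ∑ k ∈ Finset.range n, Ring.choose s k * ξ ^ k)
      =O[𝓝 0] fun ξ => ‖ξ‖ ^ n := by
    have h := (Real.one_add_rpow_hasFPowerSeriesAt_zero (a := s)).isBigO_sub_partialSum_pow n
    simpa [FormalMultilinearSeries.partialSum, binomialSeries, mul_comm] using h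
  have hglob : ∀ ξ ∈ Set.Ici (-1 : ℝ),
      |(1 + ξ) ^ s - ∑ k ∈ Finset.range n, Ring.choose s k * ξ ^ k|
        ≤ b * (1 + ‖ξ‖) ^ (⌈s⌉₊ + n) := by
    intro ξ hξ
    have hone : (1 : ℝ) ≤ 1 + |ξ| := le_add_of_nonneg_right (abs_nonneg ξ)
    have hrpow : (1 + ξ) ^ s ≤ (1 + |ξ|) ^ (⌈s⌉₊ + n) := by
      calc (1 + ξ) ^ s ≤ (1 + |ξ|) ^ s :=
            Real.rpow_le_rpow (neg_le_iff_add_nonneg'.1 hξ) (by gcongr; exact le_abs_self ξ) hs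
        _ ≤ (1 + |ξ|) ^ (⌈s⌉₊ : ℝ) := Real.rpow_le_rpow_of_exponent_le hone (Nat.le_ceil s)
        _ = (1 + |ξ|) ^ ⌈s⌉₊ := Real.rpow_natCast _ _
        _ ≤ _ := pow_le_pow_right₀ hone (Nat.le_add_right _ _)
    have hpow : ∀ k ∈ Finset.range n, |ξ| ^ k ≤ (1 + |ξ|) ^ (⌈s⌉₊ + n) := fun k hk =>
      (pow_le_pow_left₀ (abs_nonneg ξ) (by linarith) k).trans
        (pow_le_pow_right₀ hone (by have := Finset.mem_range.1 hk; omega))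
    calc |(1 + ξ) ^ s - ∑ k ∈ Finset.range n, Ring.choose s k * ξ ^ k|
        ≤ |(1 + ξ) ^ s| + ∑ k ∈ Finset.range n, |Ring.choose s k * ξ ^ k| :=
          (abs_sub _ _).trans (by gcongr; exact Finset.abs_sum_le_sum_abs _ _)
      _ ≤ (1 + |ξ|) ^ (⌈s⌉₊ + n)
          + ∑ k ∈ Finset.range n, |Ring.choose s k| * (1 + |ξ|) ^ (⌈s⌉₊ + n) := by
        rw [abs_of_nonneg (Real.rpow_nonneg (neg_le_iff_add_nonneg'.1 hξ) s)]
        gcongr with k hk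
        rw [abs_mul, abs_pow]
        gcongr
        exact hpow k hk
      _ = b * (1 + ‖ξ‖) ^ (⌈s⌉₊ + n) := by rw [← Finset.sum_mul, ← one_add_mul, Real.norm_eq_abs]
  obtain ⟨C, hC, h⟩ := exists_norm_le_pow_mul_one_add_norm_pow (by positivity) hloc hglob
  exact ⟨C, hC, _, h⟩

theorem ring_choose_two_right (s : ℝ) : Ring.choose s 2 = s * (s - 1) / 2 := by
  rw [Ring.choose_eq_smul, descPochhammer_succ_right, descPochhammer_one]
  simp [Polynomial.smeval_mul, Polynomial.smeval_sub, Nat.factorial]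
  ring

theorem exists_one_add_rpow_le_cubic {s : ℝ} (hs : 0 ≤ s) :
    ∃ c C : ℝ, 0 ≤ C ∧ ∃ M : ℕ, ∀ ξ : ℝ, -1 ≤ ξ → (1 + ξ) ^ s ≤
      1 + s * ξ + s * (s - 1) / 2 * ξ ^ 2 + c * ξ ^ 3 + C * (ξ ^ 2) ^ 2 * (1 + |ξ|) ^ M := by
  obtain ⟨C, hC, M, h⟩ := exists_abs_one_add_rpow_sub_sum_choose_le hs 4
  refine ⟨Ring.choose s 3, C, hC, M, fun ξ hξ => ?_⟩
  have hle := (abs_le.1 (h ξ hξ)).2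
  rw [show |ξ| ^ 4 = (ξ ^ 2) ^ 2 by rw [← sq_abs ξ]; ring] at hle
  simp only [Finset.sum_range_succ, Finset.sum_range_zero, Ring.choose_zero_right,
    Ring.choose_one_right, ring_choose_two_right, pow_zero, pow_one, zero_add, mul_one] at hle
  linarith

/- Averaging over `±v` cancels `v ^ 3`, which is only of size `σ ^ (3 / 2)`. -/
theorem exists_one_add_rpow_add_one_sub_rpow_le {s : ℝ} (hs : 0 ≤ s) :
    ∃ C : ℝ, 0 ≤ C ∧ ∃ M : ℕ, ∀ a v σ : ℝ, |a| ≤ σ → v ^ 2 ≤ σ → -1 ≤ a + v → -1 ≤ a - v →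
      (1 + (a + v)) ^ s + (1 + (a - v)) ^ s
        ≤ 2 * (1 + s * a + s * (s - 1) / 2 * v ^ 2) + C * σ ^ 2 * (1 + σ) ^ M := by
  obtain ⟨c, C, hC, M, taylor⟩ := exists_one_add_rpow_le_cubic hs
  refine ⟨|s * (s - 1)| + 8 * |c| + 8 * C * 2 ^ M, by positivity, M + 2,
    fun a v σ ha hv h₁ h₂ => ?_⟩
  have hσ : 0 ≤ σ := (abs_nonneg a).trans ha
  have ha2 : a ^ 2 ≤ σ ^ 2 := sq_le_sq' (abs_le.1 ha).1 (abs_le.1 ha).2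
  have quartic : ∀ ξ : ℝ, ξ ^ 2 ≤ 2 * σ * (1 + σ) →
      C * (ξ ^ 2) ^ 2 * (1 + |ξ|) ^ M ≤ 4 * C * 2 ^ M * (σ ^ 2 * (1 + σ) ^ (M + 2)) := by
    intro ξ hξ
    have hξ1 : |ξ| ≤ 1 + 2 * σ := abs_le_of_sq_le_sq (by nlinarith) (by positivity)
    calc C * (ξ ^ 2) ^ 2 * (1 + |ξ|) ^ M
        ≤ C * (2 * σ * (1 + σ)) ^ 2 * (2 * (1 + σ)) ^ M := by gcongr; linarith
      _ = _ := by rw [mul_pow 2 (1 + σ) M]; ring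
  have cubic : c * (2 * a ^ 3 + 6 * (a * v ^ 2)) ≤ 8 * |c| * (σ ^ 2 * (1 + σ) ^ (M + 2)) := by
    have h₃ : |a ^ 3| ≤ σ ^ 2 * (1 + σ) := by rw [abs_pow, pow_succ, sq_abs]; gcongr; linarith
    have h₄ : |a * v ^ 2| ≤ σ ^ 2 * (1 + σ) := by
      rw [abs_mul, abs_of_nonneg (sq_nonneg v)]
      nlinarith [mul_le_mul ha hv (sq_nonneg v) hσ, pow_nonneg hσ 3]
    calc c * (2 * a ^ 3 + 6 * (a * v ^ 2)) ≤ |c| * |2 * a ^ 3 + 6 * (a * v ^ 2)| := by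
          rw [← abs_mul]; exact le_abs_self _
      _ ≤ |c| * (8 * (σ ^ 2 * (1 + σ))) := by
        gcongr
        rw [abs_le] at h₃ h₄ ⊢
        constructor <;> linarith
      _ = 8 * |c| * (σ ^ 2 * (1 + σ) ^ 1) := by ring
      _ ≤ 8 * |c| * (σ ^ 2 * (1 + σ) ^ (M + 2)) := by gcongr <;> linarith
  have quadratic : s * (s - 1) * a ^ 2 ≤ |s * (s - 1)| * (σ ^ 2 * (1 + σ) ^ (M + 2)) := by
    gcongr
    · exact le_abs_self _
    · exact ha2.trans (le_mul_of_one_le_right (sq_nonneg σ) (one_le_pow₀ (by linarith)))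
  linarith [taylor _ h₁, taylor _ h₂, quartic (a + v) (by nlinarith [sq_nonneg (a - v)]),
    quartic (a - v) (by nlinarith [sq_nonneg (a + v)])]

end Binomial

section TraceNorm

variable {l n d : ℕ}

section Frobenius

attribute [local instance] Matrix.frobeniusNormedAddCommGroup Matrix.frobeniusNormedSpace

theorem traceNorm_eq_frobenius_norm (A : Matrix (Fin n) (Fin d) ℝ) : traceNorm A = ‖A‖ := by
  rw [Matrix.frobenius_norm_def, ← Real.sqrt_eq_rpow, traceNorm, Matrix.trace, Finset.sum_comm]
  simp [Matrix.mul_apply, pow_two]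

theorem traceNorm_mul_le (A : Matrix (Fin l) (Fin n) ℝ) (B : Matrix (Fin n) (Fin d) ℝ) :
    traceNorm (A * B) ≤ traceNorm A * traceNorm B := by
  simpa only [traceNorm_eq_frobenius_norm] using Matrix.frobenius_norm_mul A B

theorem traceNorm_transpose (A : Matrix (Fin n) (Fin d) ℝ) : traceNorm Aᵀ = traceNorm A := by
  simpa only [traceNorm_eq_frobenius_norm] using Matrix.frobenius_norm_transpose A

theorem traceNorm_smul (c : ℝ) (A : Matrix (Fin n) (Fin d) ℝ) :
    traceNorm (c • A) = ‖c‖ * traceNorm A := by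
  simpa only [traceNorm_eq_frobenius_norm] using norm_smul c A

theorem norm_toEuclideanLin_le (A : Matrix (Fin n) (Fin d) ℝ) (x : EuclideanSpace ℝ (Fin d)) :
    ‖A.toEuclideanLin x‖ ≤ traceNorm A * ‖x‖ := by
  have h := Matrix.frobenius_norm_mul A (Matrix.replicateCol Unit x.ofLp)
  rwa [← Matrix.replicateCol_mulVec, Matrix.frobenius_norm_replicateCol,
    Matrix.frobenius_norm_replicateCol, ← traceNorm_eq_frobenius_norm] at h

end Frobenius

theorem traceNorm_nonneg (A : Matrix (Fin n) (Fin d) ℝ) : 0 ≤ traceNorm A :=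
  Real.sqrt_nonneg _

theorem traceNorm_sq (A : Matrix (Fin n) (Fin d) ℝ) : traceNorm A ^ 2 = (Aᵀ * A).trace :=
  Real.sq_sqrt (Matrix.posSemidef_conjTranspose_mul_self A).trace_nonneg

theorem traceNorm_sq_eq_sum_norm_row (A : Matrix (Fin n) (Fin d) ℝ) :
    traceNorm A ^ 2 = ∑ i, ‖WithLp.toLp 2 (A i)‖ ^ 2 := by
  rw [traceNorm_sq, Matrix.trace_mul_comm]
  simp only [EuclideanSpace.real_norm_sq_eq]
  simp [Matrix.trace, Matrix.mul_apply, pow_two]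

theorem norm_toEuclideanLin_sq (A : Matrix (Fin n) (Fin d) ℝ) (x : EuclideanSpace ℝ (Fin d)) :
    ‖A.toEuclideanLin x‖ ^ 2 = ∑ i, inner ℝ (WithLp.toLp 2 (A i)) x ^ 2 := by
  rw [EuclideanSpace.real_norm_sq_eq]
  simp [Matrix.mulVec, dotProduct, PiLp.inner_apply, mul_comm]

theorem inner_toEuclideanLin_right (A : Matrix (Fin n) (Fin d) ℝ)
    (x : EuclideanSpace ℝ (Fin n)) (y : EuclideanSpace ℝ (Fin d)) :
    inner ℝ x (A.toEuclideanLin y) = inner ℝ (Aᵀ.toEuclideanLin x) y := by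
  rw [← Matrix.conjTranspose_eq_transpose_of_trivial,
    Matrix.toEuclideanLin_conjTranspose_eq_adjoint, LinearMap.adjoint_inner_left]

end TraceNorm

section Gaussian

theorem lintegral_ofReal_le_of_add_neg_le {G : Type*} [AddGroup G] [MeasurableSpace G]
    [MeasurableNeg G] {μ : Measure G} [μ.IsNegInvariant] {φ ψ : G → ℝ} (hφ : Measurable φ)
    (hφ0 : ∀ b, 0 ≤ φ b) (hψ : Integrable ψ μ) (h : ∀ b, φ b + φ (-b) ≤ 2 * ψ b) :
    ∫⁻ b, ENNReal.ofReal (φ b) ∂μ ≤ ENNReal.ofReal (∫ b, ψ b ∂μ) := by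
  have hψ0 : ∀ b, 0 ≤ ψ b := fun b => by linarith [h b, hφ0 b, hφ0 (-b)]
  refine (ENNReal.mul_le_mul_iff_right two_ne_zero (by simp)).1 ?_
  calc 2 * ∫⁻ b, ENNReal.ofReal (φ b) ∂μ
      = ∫⁻ b, ENNReal.ofReal (φ b) ∂μ + ∫⁻ b, ENNReal.ofReal (φ (-b)) ∂μ := by
        rw [lintegral_neg_eq_self (μ := μ) fun b => ENNReal.ofReal (φ b), two_mul]
    _ = ∫⁻ b, ENNReal.ofReal (φ b + φ (-b)) ∂μ := by
        rw [← lintegral_add_left (by fun_prop)]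
        simp only [ENNReal.ofReal_add (hφ0 _) (hφ0 _)]
    _ ≤ ∫⁻ b, ENNReal.ofReal (2 * ψ b) ∂μ :=
        lintegral_mono fun b => ENNReal.ofReal_le_ofReal (h b)
    _ = 2 * ENNReal.ofReal (∫ b, ψ b ∂μ) := by
        rw [← ofReal_integral_eq_lintegral_ofReal (hψ.const_mul 2)
          (Eventually.of_forall fun b => mul_nonneg zero_le_two (hψ0 b)), integral_const_mul,
          ENNReal.ofReal_mul zero_le_two, ENNReal.ofReal_ofNat]

variable {E : Type*} [NormedAddCommGroup E] [InnerProductSpace ℝ E] [FiniteDimensional ℝ E]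
  [MeasurableSpace E] [BorelSpace E]

instance isNegInvariant_stdGaussian : (stdGaussian E).IsNegInvariant :=
  ⟨stdGaussian_map (E := E) (F := E) (LinearIsometryEquiv.neg ℝ)⟩

theorem integrable_one_add_norm_pow_stdGaussian (k : ℕ) :
    Integrable (fun b => (1 + ‖b‖) ^ k) (stdGaussian E) := by
  have hnorm : MemLp (fun b => ‖b‖) k (stdGaussian E) :=
    (IsGaussian.memLp_id (stdGaussian E) k (ENNReal.natCast_ne_top k)).norm
  have h : MemLp (fun b => 1 + ‖b‖) k (stdGaussian E) := (memLp_const (1 : ℝ)).add hnorm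
  have hpos (b : E) : ‖1 + ‖b‖‖ = 1 + ‖b‖ := Real.norm_of_nonneg (by positivity)
  simpa only [hpos] using h.integrable_norm_pow'

theorem integrable_inner_sq_stdGaussian (u : E) :
    Integrable (fun b => inner ℝ u b ^ 2) (stdGaussian E) :=
  (IsGaussian.memLp_dual (stdGaussian E) (innerSL ℝ u) 2 (by simp)).integrable_sq

theorem integral_inner_sq_stdGaussian (u : E) :
    ∫ b, inner ℝ u b ^ 2 ∂stdGaussian E = ‖u‖ ^ 2 := by
  have h := variance_dual_stdGaussian (innerSL ℝ u)
  rwa [variance_of_integral_eq_zero (by fun_prop) (integral_strongDual_stdGaussian _),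
    innerSL_apply_norm] at h

variable {n d : ℕ}

theorem integrable_norm_toEuclideanLin_sq_stdGaussian (A : Matrix (Fin n) (Fin d) ℝ) :
    Integrable (fun b => ‖A.toEuclideanLin b‖ ^ 2) (stdGaussian (EuclideanSpace ℝ (Fin d))) := by
  simp only [norm_toEuclideanLin_sq]
  exact integrable_finsetSum _ fun i _ => integrable_inner_sq_stdGaussian _

theorem integral_norm_toEuclideanLin_sq_stdGaussian (A : Matrix (Fin n) (Fin d) ℝ) :
    ∫ b, ‖A.toEuclideanLin b‖ ^ 2 ∂stdGaussian (EuclideanSpace ℝ (Fin d)) = traceNorm A ^ 2 := by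
  simp only [norm_toEuclideanLin_sq, traceNorm_sq_eq_sum_norm_row]
  rw [integral_finsetSum _ fun i _ => integrable_inner_sq_stdGaussian _]
  simp only [integral_inner_sq_stdGaussian]

end Gaussian

section Step

section InnerProductSpace

variable {E : Type*} [NormedAddCommGroup E] [InnerProductSpace ℝ E]

theorem norm_add_add_sq_of_norm_eq_one {x : E} (hx : ‖x‖ = 1) (F w : E) :
    ‖x + F + w‖ ^ 2 = 1 + ((2 * inner ℝ x F + ‖F‖ ^ 2 + ‖w‖ ^ 2) + 2 * inner ℝ (x + F) w) := by
  rw [norm_add_sq_real, norm_add_sq_real, hx]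
  ring

theorem abs_norm_add_sq_sub_norm_sq_le (x y : E) :
    |‖x + y‖ ^ 2 - ‖x‖ ^ 2| ≤ ‖y‖ * (2 * ‖x‖ + ‖y‖) := by
  have h := abs_le.1 (abs_real_inner_le_norm x y)
  rw [norm_add_sq_real, abs_le]
  constructor <;> nlinarith [sq_nonneg ‖y‖]

theorem abs_two_mul_inner_add_le {x F w : E} {τ K N : ℝ} (hx : ‖x‖ = 1) (hτ : τ ≤ K)
    (hF : ‖F‖ ≤ τ) (hw : ‖w‖ ^ 2 ≤ τ * N ^ 2) (hN : 1 ≤ N) :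
    |2 * inner ℝ x F + ‖F‖ ^ 2 + ‖w‖ ^ 2| ≤ 4 * (1 + K) ^ 2 * τ * N ^ 2 := by
  have hτ0 : 0 ≤ τ := (norm_nonneg F).trans hF
  have hxF : |inner ℝ x F| ≤ τ := (abs_real_inner_le_norm x F).trans (by rwa [hx, one_mul])
  have hK : 0 ≤ K := hτ0.trans hτ
  calc |2 * inner ℝ x F + ‖F‖ ^ 2 + ‖w‖ ^ 2| ≤ 2 * |inner ℝ x F| + ‖F‖ ^ 2 + ‖w‖ ^ 2 := by
        refine (abs_add_three _ _ _).trans_eq ?_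
        rw [abs_mul, abs_two, abs_of_nonneg (sq_nonneg ‖F‖), abs_of_nonneg (sq_nonneg ‖w‖)]
    _ ≤ 2 * τ + τ * K + τ * N ^ 2 := by
        gcongr
        rw [sq]
        exact mul_le_mul hF (hF.trans hτ) (norm_nonneg F) hτ0
    _ ≤ (3 + K) * τ * N ^ 2 := by
        have h : (2 + K) * τ ≤ (2 + K) * τ * N ^ 2 :=
          le_mul_of_one_le_right (by positivity) (one_le_pow₀ hN)
        linarith
    _ ≤ 4 * (1 + K) ^ 2 * τ * N ^ 2 := by
        gcongr
        nlinarith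

theorem two_mul_inner_add_sq_le {x F w : E} {τ K N : ℝ} (hx : ‖x‖ = 1) (hτ : τ ≤ K)
    (hF : ‖F‖ ≤ τ) (hw : ‖w‖ ^ 2 ≤ τ * N ^ 2) :
    (2 * inner ℝ (x + F) w) ^ 2 ≤ 4 * (1 + K) ^ 2 * τ * N ^ 2 := by
  have hxF : ‖x + F‖ ≤ 1 + K := (norm_add_le x F).trans (by linarith)
  calc (2 * inner ℝ (x + F) w) ^ 2 = 4 * |inner ℝ (x + F) w| ^ 2 := by rw [sq_abs]; ring
    _ ≤ 4 * (‖x + F‖ * ‖w‖) ^ 2 := by gcongr; exact abs_real_inner_le_norm _ _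
    _ = 4 * ‖x + F‖ ^ 2 * ‖w‖ ^ 2 := by ring
    _ ≤ 4 * (1 + K) ^ 2 * (τ * N ^ 2) := by gcongr
    _ = 4 * (1 + K) ^ 2 * τ * N ^ 2 := by ring

theorem exists_norm_add_rpow_add_norm_sub_rpow_le {p K : ℝ} (hp : 0 ≤ p) (hK : 0 ≤ K) :
    ∃ C, 0 ≤ C ∧ ∃ M : ℕ, ∀ (x F w : E) (τ N : ℝ), ‖x‖ = 1 → τ ≤ K → ‖F‖ ≤ τ →
      ‖w‖ ^ 2 ≤ τ * N ^ 2 → 1 ≤ N →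
      ‖x + F + w‖ ^ p + ‖x + F - w‖ ^ p ≤ 2 * (1 + p / 2 * (2 * inner ℝ x F + ‖F‖ ^ 2 + ‖w‖ ^ 2)
        + p / 2 * (p / 2 - 1) / 2 * (2 * inner ℝ (x + F) w) ^ 2) + C * τ ^ 2 * N ^ M := by
  obtain ⟨C, hC, M, hbinom⟩ := exists_one_add_rpow_add_one_sub_rpow_le (div_nonneg hp zero_le_two)
  set c : ℝ := 4 * (1 + K) ^ 2
  refine ⟨C * c ^ 2 * (1 + c * K) ^ M, by positivity, 4 + 2 * M, fun x F w τ N hx hτ hF hw hN => ?_⟩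
  have hτ0 : 0 ≤ τ := (norm_nonneg F).trans hF
  have hplus := norm_add_add_sq_of_norm_eq_one hx F w
  have hminus := norm_add_add_sq_of_norm_eq_one hx F (-w)
  rw [norm_neg, inner_neg_right, mul_neg, ← sub_eq_add_neg, ← sub_eq_add_neg] at hminus
  have hrpow : ∀ y : E, ‖y‖ ^ p = (‖y‖ ^ 2) ^ (p / 2) := fun y => by
    rw [← Real.rpow_natCast, ← Real.rpow_mul (norm_nonneg y)]
    congr 1
    push_cast
    ring
  have hσ : 1 + c * τ * N ^ 2 ≤ (1 + c * K) * N ^ 2 := by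
    have : c * τ * N ^ 2 ≤ c * K * N ^ 2 := by gcongr
    nlinarith [one_le_pow₀ (n := 2) hN]
  rw [hrpow, hrpow, hplus, hminus]
  refine (hbinom _ _ _ (abs_two_mul_inner_add_le hx hτ hF hw hN)
    (two_mul_inner_add_sq_le hx hτ hF hw) (by linarith [sq_nonneg ‖x + F + w‖])
    (by linarith [sq_nonneg ‖x + F - w‖])).trans (add_le_add_right ?_ _)
  calc C * (c * τ * N ^ 2) ^ 2 * (1 + c * τ * N ^ 2) ^ M
      ≤ C * (c * τ * N ^ 2) ^ 2 * ((1 + c * K) * N ^ 2) ^ M := by gcongr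
    _ = C * c ^ 2 * (1 + c * K) ^ M * τ ^ 2 * N ^ (4 + 2 * M) := by
        rw [mul_pow (1 + c * K), ← pow_mul]
        ring

end InnerProductSpace

end Step

section GaussianStep

variable {n d : ℕ}

theorem integrable_and_integral_quadratic_add_pow_stdGaussian (A : Matrix (Fin n) (Fin d) ℝ)
    (u : EuclideanSpace ℝ (Fin d)) (c₀ c₁ c₂ c₃ : ℝ) (M : ℕ) :
    let ψ b := c₀ + c₁ * ‖A.toEuclideanLin b‖ ^ 2 + c₂ * inner ℝ u b ^ 2 + c₃ * (1 + ‖b‖) ^ M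
    Integrable ψ (stdGaussian _) ∧ ∫ b, ψ b ∂stdGaussian _ = c₀ + c₁ * traceNorm A ^ 2
      + c₂ * ‖u‖ ^ 2 + c₃ * ∫ b, (1 + ‖b‖) ^ M ∂stdGaussian (EuclideanSpace ℝ (Fin d)) := by
  have h₁ := (integrable_const (μ := stdGaussian (EuclideanSpace ℝ (Fin d))) c₀).add
    ((integrable_norm_toEuclideanLin_sq_stdGaussian A).const_mul c₁)
  have h₂ := h₁.add ((integrable_inner_sq_stdGaussian u).const_mul c₂)
  have h₃ := (integrable_one_add_norm_pow_stdGaussian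
    (E := EuclideanSpace ℝ (Fin d)) M).const_mul c₃
  refine ⟨h₂.add h₃, (integral_add h₂ h₃).trans ?_⟩
  rw [integral_add' h₁ ((integrable_inner_sq_stdGaussian u).const_mul c₂),
    integral_add' (integrable_const c₀)
      ((integrable_norm_toEuclideanLin_sq_stdGaussian A).const_mul c₁),
    integral_const_mul, integral_const_mul, integral_const_mul,
    integral_norm_toEuclideanLin_sq_stdGaussian, integral_inner_sq_stdGaussian, integral_const,
    probReal_univ, one_smul]

theorem abs_norm_transpose_add_sq_sub_le {τ K : ℝ} {x F : EuclideanSpace ℝ (Fin n)}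
    {G : Matrix (Fin n) (Fin d) ℝ} (hx : ‖x‖ = 1) (hτ : τ ≤ K) (hF : ‖F‖ ≤ τ)
    (hG : traceNorm G ^ 2 ≤ τ) :
    |‖Gᵀ.toEuclideanLin (x + F)‖ ^ 2 - ‖Gᵀ.toEuclideanLin x‖ ^ 2| ≤ (2 + K) * τ ^ 2 := by
  have hτ0 : 0 ≤ τ := (norm_nonneg F).trans hF
  have hG0 := traceNorm_nonneg G
  have hGx : ‖Gᵀ.toEuclideanLin x‖ ≤ traceNorm G := by
    simpa only [traceNorm_transpose, hx, mul_one] using norm_toEuclideanLin_le Gᵀ x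
  have hGF : ‖Gᵀ.toEuclideanLin F‖ ≤ traceNorm G * τ := by
    rw [← traceNorm_transpose]
    exact (norm_toEuclideanLin_le Gᵀ F).trans
      (mul_le_mul_of_nonneg_left hF (traceNorm_nonneg _))
  rw [map_add]
  calc _ ≤ ‖Gᵀ.toEuclideanLin F‖ * (2 * ‖Gᵀ.toEuclideanLin x‖ + ‖Gᵀ.toEuclideanLin F‖) :=
        abs_norm_add_sq_sub_norm_sq_le _ _
    _ ≤ traceNorm G * τ * (2 * traceNorm G + traceNorm G * τ) := by gcongr
    _ = traceNorm G ^ 2 * (τ * (2 + τ)) := by ring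
    _ ≤ τ * (τ * (2 + K)) := by gcongr
    _ = (2 + K) * τ ^ 2 := by ring

theorem second_order_expansion_le {p ρ τ K β : ℝ} {x F : EuclideanSpace ℝ (Fin n)}
    {G : Matrix (Fin n) (Fin d) ℝ} (hp : 0 ≤ p) (hρ : p ≤ ρ) (hx : ‖x‖ = 1) (hτ : τ ≤ K)
    (hF : ‖F‖ ≤ τ) (hG : traceNorm G ^ 2 ≤ τ)
    (hβ : 2 * inner ℝ x F + traceNorm G ^ 2 - (2 - ρ) * ‖Gᵀ.toEuclideanLin x‖ ^ 2 ≤ β) :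
    p / 2 * (2 * inner ℝ x F + ‖F‖ ^ 2 + traceNorm G ^ 2)
        + p / 2 * (p / 2 - 1) / 2 * (4 * ‖Gᵀ.toEuclideanLin (x + F)‖ ^ 2)
      ≤ p / 2 * β + (p / 2 + 2 * |p / 2 * (p / 2 - 1)| * (2 + K)) * τ ^ 2 := by
  set X := ‖Gᵀ.toEuclideanLin x‖ ^ 2
  set Y := ‖Gᵀ.toEuclideanLin (x + F)‖ ^ 2
  have hFτ : ‖F‖ ^ 2 ≤ τ ^ 2 := pow_le_pow_left₀ (norm_nonneg F) hF 2
  have hXp : 2 * inner ℝ x F + traceNorm G ^ 2 + (p - 2) * X ≤ β := by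
    have := mul_le_mul_of_nonneg_right hρ (sq_nonneg ‖Gᵀ.toEuclideanLin x‖)
    linarith
  have hXY : p / 2 * (p / 2 - 1) * (Y - X) ≤ |p / 2 * (p / 2 - 1)| * ((2 + K) * τ ^ 2) := by
    refine (le_abs_self _).trans ?_
    rw [abs_mul]
    exact mul_le_mul_of_nonneg_left (abs_norm_transpose_add_sq_sub_le hx hτ hF hG) (abs_nonneg _)
  have : 0 ≤ p / 2 := by positivity
  calc _ = p / 2 * (2 * inner ℝ x F + traceNorm G ^ 2 + (p - 2) * X) + p / 2 * ‖F‖ ^ 2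
        + 2 * (p / 2 * (p / 2 - 1) * (Y - X)) := by ring
    _ ≤ p / 2 * β + p / 2 * τ ^ 2 + 2 * (|p / 2 * (p / 2 - 1)| * ((2 + K) * τ ^ 2)) := by gcongr
    _ = _ := by ring

theorem exists_lintegral_enorm_rpow_le_of_norm_eq_one {p ρ K : ℝ} (hp : 0 ≤ p) (hρ : p ≤ ρ)
    (hK : 0 ≤ K) :
    ∃ C, 0 ≤ C ∧ ∀ (τ β : ℝ) (x F : EuclideanSpace ℝ (Fin n)) (G : Matrix (Fin n) (Fin d) ℝ),
      ‖x‖ = 1 → τ ≤ K → ‖F‖ ≤ τ → traceNorm G ^ 2 ≤ τ →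
      2 * inner ℝ x F + traceNorm G ^ 2 - (2 - ρ) * ‖Gᵀ.toEuclideanLin x‖ ^ 2 ≤ β →
      ∫⁻ b, ‖x + F + G.toEuclideanLin b‖ₑ ^ p ∂stdGaussian (EuclideanSpace ℝ (Fin d))
        ≤ ENNReal.ofReal (1 + p / 2 * β + C * τ ^ 2) := by
  obtain ⟨C, hC, M, hpair⟩ := exists_norm_add_rpow_add_norm_sub_rpow_le
    (E := EuclideanSpace ℝ (Fin n)) hp hK
  set μ := ∫ b, (1 + ‖b‖) ^ M ∂stdGaussian (EuclideanSpace ℝ (Fin d))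
  have : 0 ≤ μ := integral_nonneg fun b => by positivity
  refine ⟨p / 2 + 2 * |p / 2 * (p / 2 - 1)| * (2 + K) + C / 2 * μ, by positivity,
    fun τ β x F G hx hτ hF hG hβ => ?_⟩
  obtain ⟨hψ, hψ_eq⟩ := integrable_and_integral_quadratic_add_pow_stdGaussian G
    (Gᵀ.toEuclideanLin (x + F)) (1 + p / 2 * (2 * inner ℝ x F + ‖F‖ ^ 2)) (p / 2)
    (p / 2 * (p / 2 - 1) / 2 * 4) (C / 2 * τ ^ 2) M
  have hτ0 : 0 ≤ τ := (norm_nonneg F).trans hF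
  have hnorm : ∀ b, ‖G.toEuclideanLin b‖ ^ 2 ≤ τ * (1 + ‖b‖) ^ 2 := fun b =>
    calc ‖G.toEuclideanLin b‖ ^ 2 ≤ (traceNorm G * ‖b‖) ^ 2 := by
          gcongr; exact norm_toEuclideanLin_le G b
      _ = traceNorm G ^ 2 * ‖b‖ ^ 2 := mul_pow _ _ _
      _ ≤ τ * (1 + ‖b‖) ^ 2 := by gcongr; linarith
  simp only [← ofReal_norm, ENNReal.ofReal_rpow_of_nonneg (norm_nonneg _) hp]
  refine (lintegral_ofReal_le_of_add_neg_le (by fun_prop) (fun b => by positivity) hψ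
    fun b => ?_).trans (ENNReal.ofReal_le_ofReal ?_)
  · have h := hpair x F (G.toEuclideanLin b) τ (1 + ‖b‖) hx hτ hF (hnorm b)
      (by linarith [norm_nonneg b])
    rw [inner_toEuclideanLin_right] at h
    rw [map_neg, ← sub_eq_add_neg]
    linarith
  · rw [hψ_eq]
    linarith [second_order_expansion_le hp hρ hx hτ hF hG hβ]

theorem exists_lintegral_enorm_rpow_le {p ρ K : ℝ} (hp : 0 < p) (hρ : p ≤ ρ) (hK : 0 ≤ K) :
    ∃ C, 0 ≤ C ∧ ∀ (τ β : ℝ) (x F : EuclideanSpace ℝ (Fin n)) (G : Matrix (Fin n) (Fin d) ℝ),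
      τ ≤ K → ‖F‖ ≤ τ * ‖x‖ → traceNorm G ^ 2 ≤ τ * ‖x‖ ^ 2 →
      ‖x‖ ^ 2 * (2 * inner ℝ x F + traceNorm G ^ 2) - (2 - ρ) * ‖Gᵀ.toEuclideanLin x‖ ^ 2
        ≤ β * (‖x‖ ^ 2) ^ 2 →
      ∫⁻ b, ‖x + F + G.toEuclideanLin b‖ₑ ^ p ∂stdGaussian (EuclideanSpace ℝ (Fin d))
        ≤ ENNReal.ofReal (1 + p / 2 * β + C * τ ^ 2) * ‖x‖ₑ ^ p := by
  obtain ⟨C, hC, hunit⟩ := exists_lintegral_enorm_rpow_le_of_norm_eq_one (n := n) (d := d)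
    hp.le hρ hK
  refine ⟨C, hC, fun τ β x F G hτ hF hG hβ => ?_⟩
  rcases eq_or_ne x 0 with rfl | hx
  · have hF0 : F = 0 := by simpa using hF
    have hG0 : traceNorm G = 0 := by simpa using hG
    have hGb : ∀ b, G.toEuclideanLin b = 0 := fun b => by
      simpa [hG0] using norm_toEuclideanLin_le G b
    simp [hF0, hGb, hp]
  obtain ⟨a, ha, e, he, rfl⟩ : ∃ a : ℝ, 0 < a ∧ ∃ e, ‖e‖ = 1 ∧ a • e = x :=
    ⟨‖x‖, norm_pos_iff.2 hx, ‖x‖⁻¹ • x, norm_smul_inv_norm hx,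
      smul_inv_smul₀ (norm_ne_zero_iff.2 hx) x⟩
  obtain ⟨F, rfl⟩ : ∃ F', a • F' = F := ⟨a⁻¹ • F, smul_inv_smul₀ ha.ne' F⟩
  obtain ⟨G, rfl⟩ : ∃ G', a • G' = G := ⟨a⁻¹ • G, smul_inv_smul₀ ha.ne' G⟩
  simp only [norm_smul, traceNorm_smul, Matrix.transpose_smul, map_smul, LinearMap.smul_apply,
    real_inner_smul_left, real_inner_smul_right, Real.norm_of_nonneg ha.le, he, mul_one] at hF hG hβ
  have h := hunit τ β e F G he hτ (by nlinarith) (by nlinarith [sq_pos_of_pos ha])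
    (le_of_mul_le_mul_left (by linarith) (pow_pos ha 4))
  have he' : ‖e‖ₑ = 1 := by rw [← ofReal_norm, he, ENNReal.ofReal_one]
  simp only [map_smul, LinearMap.smul_apply, ← smul_add, enorm_smul, he', mul_one,
    ENNReal.mul_rpow_of_nonneg _ _ hp.le]
  rw [lintegral_const_mul _ (by fun_prop), mul_comm]
  gcongr

end GaussianStep

section Lyapunov

variable {n d : ℕ} {Q R : Matrix (Fin n) (Fin n) ℝ}

open scoped MatrixOrder Matrix.Norms.L2Operator in
theorem exists_isUnit_eq_transpose_mul_self (hQ : Q.PosDef) : ∃ R, IsUnit R ∧ Q = Rᵀ * R :=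
  CStarAlgebra.isStrictlyPositive_iff_eq_star_mul_self.1 hQ.isStrictlyPositive

theorem toEuclideanLin_mul_apply {l : ℕ} (A : Matrix (Fin l) (Fin n) ℝ)
    (B : Matrix (Fin n) (Fin d) ℝ) (x : EuclideanSpace ℝ (Fin d)) :
    (A * B).toEuclideanLin x = A.toEuclideanLin (B.toEuclideanLin x) := by
  simp [Matrix.toLpLin_apply]

theorem norm_le_traceNorm_inv_mul (hR : IsUnit R) (x : EuclideanSpace ℝ (Fin n)) :
    ‖x‖ ≤ traceNorm R⁻¹ * ‖R.toEuclideanLin x‖ := by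
  have h := norm_toEuclideanLin_le R⁻¹ (R.toEuclideanLin x)
  rwa [← toEuclideanLin_mul_apply, Matrix.nonsing_inv_mul _ ((Matrix.isUnit_iff_isUnit_det R).1 hR),
    Matrix.toLpLin_one, LinearMap.id_apply] at h

theorem dotProduct_transpose_mul_self_mulVec (R : Matrix (Fin n) (Fin n) ℝ)
    (x y : EuclideanSpace ℝ (Fin n)) :
    x.ofLp ⬝ᵥ ((Rᵀ * R) *ᵥ y.ofLp) = inner ℝ (R.toEuclideanLin x) (R.toEuclideanLin y) := by
  rw [← Matrix.mulVec_mulVec, Matrix.dotProduct_mulVec, Matrix.vecMul_transpose, dotProduct_comm]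
  rfl

theorem trace_transpose_mul_transpose_mul_self_mul (R : Matrix (Fin n) (Fin n) ℝ)
    (G : Matrix (Fin n) (Fin d) ℝ) : (Gᵀ * (Rᵀ * R) * G).trace = traceNorm (R * G) ^ 2 := by
  rw [traceNorm_sq, Matrix.transpose_mul]
  simp only [Matrix.mul_assoc]

theorem toLp_vecMul_transpose_mul_self_mul (R : Matrix (Fin n) (Fin n) ℝ)
    (G : Matrix (Fin n) (Fin d) ℝ) (x : EuclideanSpace ℝ (Fin n)) :
    WithLp.toLp 2 (x.ofLp ᵥ* (Rᵀ * R * G)) = (R * G)ᵀ.toEuclideanLin (R.toEuclideanLin x) := by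
  rw [← toEuclideanLin_mul_apply, Matrix.toLpLin_apply, ← Matrix.mulVec_transpose,
    Matrix.mul_assoc, Matrix.transpose_mul, Matrix.transpose_transpose]

theorem StabilityAssumption.bound_norm {m : ℕ}
    {f : EuclideanSpace ℝ (Fin n) → Fin m → EuclideanSpace ℝ (Fin n)}
    {g : EuclideanSpace ℝ (Fin n) → Fin m → Matrix (Fin n) (Fin d) ℝ} {β : Fin m → ℝ} {ρ : ℝ}
    (h : StabilityAssumption f g (Rᵀ * R) β ρ) (x : EuclideanSpace ℝ (Fin n)) (i : Fin m) :
    ‖R.toEuclideanLin x‖ ^ 2 * (2 * inner ℝ (R.toEuclideanLin x) (R.toEuclideanLin (f x i))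
        + traceNorm (R * g x i) ^ 2)
      - (2 - ρ) * ‖(R * g x i)ᵀ.toEuclideanLin (R.toEuclideanLin x)‖ ^ 2
      ≤ β i * (‖R.toEuclideanLin x‖ ^ 2) ^ 2 := by
  simpa only [quad, psi, dotProduct_transpose_mul_self_mulVec, real_inner_self_eq_norm_sq,
    trace_transpose_mul_transpose_mul_self_mul, toLp_vecMul_transpose_mul_self_mul]
    using h.bound x i

theorem sq_mul_le_of_rpow_mul_le {Δ H K θ : ℝ} (hΔ : 0 < Δ) (hH : 0 ≤ H)
    (h : Δ ^ (1 / 2 - θ) * H ≤ K) : (Δ * H) ^ 2 ≤ K ^ 2 * Δ ^ (1 + 2 * θ) := by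
  have hrpow : (Δ ^ (1 / 2 - θ)) ^ 2 * Δ ^ (1 + 2 * θ) = Δ ^ 2 := by
    rw [← Real.rpow_natCast, ← Real.rpow_mul hΔ.le, ← Real.rpow_add hΔ, ← Real.rpow_natCast]
    congr 1
    push_cast
    ring
  calc (Δ * H) ^ 2 = (Δ ^ (1 / 2 - θ) * H) ^ 2 * Δ ^ (1 + 2 * θ) := by
        rw [mul_pow, ← hrpow, mul_pow]
        ring
    _ ≤ K ^ 2 * Δ ^ (1 + 2 * θ) := by gcongr

theorem mul_le_of_rpow_mul_le {Δ H K θ : ℝ} (hΔ : 0 < Δ) (hΔ1 : Δ ≤ 1) (hH : 0 ≤ H) (hθ : 0 < θ)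
    (h : Δ ^ (1 / 2 - θ) * H ≤ K) : Δ * H ≤ K := by
  refine le_trans ?_ h
  gcongr
  calc Δ = Δ ^ (1 : ℝ) := (Real.rpow_one Δ).symm
    _ ≤ Δ ^ (1 / 2 - θ) := Real.rpow_le_rpow_of_exponent_ge hΔ hΔ1 (by linarith)

theorem norm_toEuclideanLin_le_of_norm_le (hR : IsUnit R) {H : ℝ} (hH : 0 ≤ H)
    {x F : EuclideanSpace ℝ (Fin n)} (hF : ‖F‖ ≤ H * ‖x‖) :
    ‖R.toEuclideanLin F‖ ≤ traceNorm R * traceNorm R⁻¹ * H * ‖R.toEuclideanLin x‖ :=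
  calc ‖R.toEuclideanLin F‖ ≤ traceNorm R * ‖F‖ := norm_toEuclideanLin_le R F
    _ ≤ traceNorm R * (H * (traceNorm R⁻¹ * ‖R.toEuclideanLin x‖)) := by
        have hR0 := traceNorm_nonneg R
        gcongr
        exact hF.trans (by gcongr; exact norm_le_traceNorm_inv_mul hR x)
    _ = traceNorm R * traceNorm R⁻¹ * H * ‖R.toEuclideanLin x‖ := by ring

theorem traceNorm_mul_sq_le (hR : IsUnit R) {H : ℝ} (hH : 0 ≤ H)
    {x : EuclideanSpace ℝ (Fin n)} {G : Matrix (Fin n) (Fin d) ℝ}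
    (hG : traceNorm G ^ 2 ≤ H * ‖x‖ ^ 2) :
    traceNorm (R * G) ^ 2
      ≤ (traceNorm R * traceNorm R⁻¹) ^ 2 * H * ‖R.toEuclideanLin x‖ ^ 2 :=
  calc traceNorm (R * G) ^ 2 ≤ (traceNorm R * traceNorm G) ^ 2 :=
        pow_le_pow_left₀ (traceNorm_nonneg _) (traceNorm_mul_le R G) 2
    _ = traceNorm R ^ 2 * traceNorm G ^ 2 := mul_pow _ _ _
    _ ≤ traceNorm R ^ 2 * (H * (traceNorm R⁻¹ * ‖R.toEuclideanLin x‖) ^ 2) := by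
        gcongr
        exact hG.trans (by gcongr; exact norm_le_traceNorm_inv_mul hR x)
    _ = (traceNorm R * traceNorm R⁻¹) ^ 2 * H * ‖R.toEuclideanLin x‖ ^ 2 := by ring

theorem exists_lintegral_enorm_toEuclideanLin_le (hR : IsUnit R) {p ρ K : ℝ} (hp : 0 < p)
    (hρ : p ≤ ρ) (hK : 0 ≤ K) :
    ∃ C, 0 ≤ C ∧ ∀ (τ β : ℝ) (x F : EuclideanSpace ℝ (Fin n)) (G : Matrix (Fin n) (Fin d) ℝ),
      0 ≤ τ → τ ≤ K → ‖F‖ ≤ τ * ‖x‖ → traceNorm G ^ 2 ≤ τ * ‖x‖ ^ 2 →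
      ‖R.toEuclideanLin x‖ ^ 2 * (2 * inner ℝ (R.toEuclideanLin x) (R.toEuclideanLin F)
          + traceNorm (R * G) ^ 2)
        - (2 - ρ) * ‖(R * G)ᵀ.toEuclideanLin (R.toEuclideanLin x)‖ ^ 2
        ≤ β * (‖R.toEuclideanLin x‖ ^ 2) ^ 2 →
      ∫⁻ b, ‖R.toEuclideanLin (x + F + G.toEuclideanLin b)‖ₑ ^ p
          ∂stdGaussian (EuclideanSpace ℝ (Fin d))
        ≤ ENNReal.ofReal (1 + p / 2 * β + C * τ ^ 2) * ‖R.toEuclideanLin x‖ₑ ^ p := by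
  set k := traceNorm R * traceNorm R⁻¹
  have hk : 0 ≤ k := mul_nonneg (traceNorm_nonneg _) (traceNorm_nonneg _)
  obtain ⟨C, hC, hstep⟩ := exists_lintegral_enorm_rpow_le (n := n) (d := d) (K := (k + k ^ 2) * K)
    hp hρ (by positivity)
  refine ⟨C * (k + k ^ 2) ^ 2, by positivity, fun τ β x F G hτ hτK hF hG hβ => ?_⟩
  have hdrift : ‖R.toEuclideanLin F‖ ≤ (k + k ^ 2) * τ * ‖R.toEuclideanLin x‖ :=
    (norm_toEuclideanLin_le_of_norm_le hR hτ hF).trans (by gcongr; nlinarith)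
  have hdiff : traceNorm (R * G) ^ 2 ≤ (k + k ^ 2) * τ * ‖R.toEuclideanLin x‖ ^ 2 :=
    (traceNorm_mul_sq_le hR hτ hG).trans (by gcongr; exact le_add_of_nonneg_left hk)
  have h := hstep ((k + k ^ 2) * τ) β _ _ _ (by gcongr) hdrift hdiff hβ
  simp only [map_add, ← toEuclideanLin_mul_apply]
  exact h.trans_eq (by ring_nf)

theorem exists_lintegral_enorm_step_le (hR : IsUnit R) {p ρ K θ : ℝ} (hp : 0 < p) (hρ : p ≤ ρ)
    (hK : 0 ≤ K) (hθ : 0 < θ) :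
    ∃ C, ∀ (Δ H β : ℝ) (x F : EuclideanSpace ℝ (Fin n)) (G : Matrix (Fin n) (Fin d) ℝ),
      0 < Δ → Δ ≤ 1 → 0 ≤ H → Δ ^ (1 / 2 - θ) * H ≤ K → ‖F‖ ≤ H * ‖x‖ →
      traceNorm G ^ 2 ≤ H * ‖x‖ ^ 2 →
      ‖R.toEuclideanLin x‖ ^ 2 * (2 * inner ℝ (R.toEuclideanLin x) (R.toEuclideanLin F)
          + traceNorm (R * G) ^ 2)
        - (2 - ρ) * ‖(R * G)ᵀ.toEuclideanLin (R.toEuclideanLin x)‖ ^ 2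
        ≤ β * (‖R.toEuclideanLin x‖ ^ 2) ^ 2 →
      ∫⁻ w, ‖R.toEuclideanLin (x + Δ • F + G.toEuclideanLin w)‖ₑ ^ p
          ∂(stdGaussian (EuclideanSpace ℝ (Fin d))).map (√Δ • ·)
        ≤ ENNReal.ofReal (Real.exp (p / 2 * β * Δ + C * Δ ^ (1 + 2 * θ)))
          * ‖R.toEuclideanLin x‖ₑ ^ p := by
  obtain ⟨C, hC, hstep⟩ := exists_lintegral_enorm_toEuclideanLin_le (d := d) hR hp hρ hK
  refine ⟨C * K ^ 2, fun Δ H β x F G hΔ hΔ1 hH hHK hF hG hβ => ?_⟩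
  have hdrift : ‖Δ • F‖ ≤ Δ * H * ‖x‖ := by
    rw [norm_smul, Real.norm_of_nonneg hΔ.le, mul_assoc]
    gcongr
  have hdiff : traceNorm (√Δ • G) ^ 2 ≤ Δ * H * ‖x‖ ^ 2 := by
    rw [traceNorm_smul, mul_pow, Real.norm_eq_abs, sq_abs, Real.sq_sqrt hΔ.le, mul_assoc]
    gcongr
  have hform := mul_le_mul_of_nonneg_left hβ hΔ.le
  have h := hstep (Δ * H) (Δ * β) x (Δ • F) (√Δ • G) (by positivity)
    (mul_le_of_rpow_mul_le hΔ hΔ1 hH hθ hHK) hdrift hdiff (by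
      simp only [real_inner_smul_right, traceNorm_smul, Matrix.transpose_smul, Matrix.mul_smul,
        map_smul, LinearMap.smul_apply, norm_smul, mul_pow, Real.norm_eq_abs, sq_abs,
        Real.sq_sqrt hΔ.le]
      linarith)
  have hRG : Continuous fun w => R.toEuclideanLin (x + Δ • F + G.toEuclideanLin w) :=
    R.toEuclideanLin.continuous_of_finiteDimensional.comp
      (continuous_const.add G.toEuclideanLin.continuous_of_finiteDimensional)
  rw [lintegral_map (hRG.enorm.measurable.pow_const p) (by fun_prop)]
  simp only [map_smul, LinearMap.smul_apply] at h ⊢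
  refine h.trans (mul_le_mul_left (ENNReal.ofReal_le_ofReal ?_) _)
  have hexp := Real.add_one_le_exp (p / 2 * β * Δ + C * K ^ 2 * Δ ^ (1 + 2 * θ))
  have hsq := mul_le_mul_of_nonneg_left (sq_mul_le_of_rpow_mul_le hΔ hH hHK) hC
  linarith

end Lyapunov

section Truncation

variable {n d m : ℕ}

theorem enorm_trunc (c : ℝ≥0∞) (x : EuclideanSpace ℝ (Fin n)) :
    ‖trunc c x‖ₑ = min ‖x‖ₑ c := by
  rcases eq_or_ne x 0 with rfl | hx
  · simp [trunc]
  · have hmin : min ‖x‖ₑ c ≠ ⊤ := ne_top_of_le_ne_top enorm_ne_top (min_le_left _ _)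
    have hnorm : ‖trunc c x‖ = (min ‖x‖ₑ c).toReal := by
      rw [trunc, norm_smul, norm_smul, norm_inv, norm_norm,
        inv_mul_cancel₀ (norm_ne_zero_iff.2 hx), mul_one,
        Real.norm_of_nonneg ENNReal.toReal_nonneg]
    rw [← ofReal_norm, hnorm, ENNReal.ofReal_toReal hmin]

theorem enorm_map_trunc_le {F : Type*} [SeminormedAddCommGroup F] [NormedSpace ℝ F]
    (L : EuclideanSpace ℝ (Fin n) →ₗ[ℝ] F) (c : ℝ≥0∞) (x : EuclideanSpace ℝ (Fin n)) :
    ‖L (trunc c x)‖ₑ ≤ ‖L x‖ₑ := by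
  have hc : (min ‖x‖ₑ c).toReal ≤ ‖x‖ := by
    rw [← toReal_enorm x]
    exact ENNReal.toReal_mono enorm_ne_top (min_le_left _ _)
  rw [enorm_le_iff_norm_le, trunc, smul_smul, map_smul, norm_smul, ← div_eq_mul_inv, norm_div,
    norm_norm, Real.norm_of_nonneg ENNReal.toReal_nonneg]
  exact mul_le_of_le_one_left (norm_nonneg _) (div_le_one_of_le₀ hc (norm_nonneg _))

theorem measurable_trunc (c : ℝ≥0∞) : Measurable (trunc c : EuclideanSpace ℝ (Fin n) → _) := by
  unfold trunc
  fun_prop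

theorem ofReal_le_truncRadius {ψ : ℝ → ℝ} {u v : ℝ} (hu : 0 ≤ u) (h : ψ u ≤ v) :
    ENNReal.ofReal u ≤ truncRadius ψ v :=
  le_iSup₂_of_le (f := fun (u : ℝ≥0) (_ : ψ u ≤ v) => (u : ℝ≥0∞)) u.toNNReal
    (by rwa [Real.coe_toNNReal u hu]) le_rfl

theorem le_of_ofReal_le_truncRadius {ψ : ℝ → ℝ} {u v : ℝ} (hmono : MonotoneOn ψ (Set.Ici 0))
    (hcont : ContinuousOn ψ (Set.Ici 0)) (hu : 0 < u)
    (h : ENNReal.ofReal u ≤ truncRadius ψ v) : ψ u ≤ v := by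
  have hbelow : ∀ w ∈ Set.Ico 0 u, ψ w ≤ v := fun w hw => by
    have hlt : ENNReal.ofReal w < truncRadius ψ v :=
      ((ENNReal.ofReal_lt_ofReal_iff hu).2 hw.2).trans_le h
    obtain ⟨y, hyv, hwy⟩ : ∃ y : ℝ≥0, ∃ _ : ψ y ≤ v, ENNReal.ofReal w < y := by
      simpa only [truncRadius, lt_iSup_iff] using hlt
    exact (hmono hw.1 y.2 (ENNReal.ofReal_le_coe.1 hwy.le)).trans hyv
  have htendsto : Tendsto ψ (𝓝[<] u) (𝓝 (ψ u)) :=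
    (hcont.continuousAt (Ici_mem_nhds hu)).tendsto.mono_left nhdsWithin_le_nhds
  refine le_of_tendsto htendsto ?_
  filter_upwards [Ico_mem_nhdsLT hu] with w hw using hbelow w hw

variable {f : EuclideanSpace ℝ (Fin n) → Fin m → EuclideanSpace ℝ (Fin n)}
  {g : EuclideanSpace ℝ (Fin n) → Fin m → Matrix (Fin n) (Fin d) ℝ} {φ : Fin m → ℝ → ℝ}

namespace IsLipschitzControl

theorem monotoneOn (hφ : IsLipschitzControl f g φ) (i : Fin m) :
    MonotoneOn (φ i) (Set.Ici 0) := by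
  rcases hφ.shape i with ⟨hmono, -⟩ | ⟨C, hC⟩
  · exact hmono.monotoneOn
  · exact fun u hu v hv _ => by rw [hC u hu, hC v hv]

theorem continuousOn (hφ : IsLipschitzControl f g φ) (i : Fin m) :
    ContinuousOn (φ i) (Set.Ici 0) := by
  rcases hφ.shape i with ⟨-, hcont, -⟩ | ⟨C, hC⟩
  · exact hcont
  · exact continuousOn_const.congr hC

theorem norm_sub_le (hφ : IsLipschitzControl f g φ) (i : Fin m) {u : ℝ} (hu : 1 ≤ u)
    {x y : EuclideanSpace ℝ (Fin n)} (hx : ‖x‖ ≤ u) (hy : ‖y‖ ≤ u) :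
    ‖f x i - f y i‖ ≤ φ i u * ‖x - y‖ := by
  rcases eq_or_ne x y with rfl | hxy
  · simp
  · exact (div_le_iff₀ (norm_sub_pos_iff.2 hxy)).1
      ((le_max_left _ _).trans (hφ.bound i u hu x y (max_le hx hy) hxy))

theorem traceNorm_sub_sq_le (hφ : IsLipschitzControl f g φ) (i : Fin m) {u : ℝ} (hu : 1 ≤ u)
    {x y : EuclideanSpace ℝ (Fin n)} (hx : ‖x‖ ≤ u) (hy : ‖y‖ ≤ u) :
    traceNorm (g x i - g y i) ^ 2 ≤ φ i u * ‖x - y‖ ^ 2 := by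
  rcases eq_or_ne x y with rfl | hxy
  · simp [traceNorm]
  · exact (div_le_iff₀ (pow_pos (norm_sub_pos_iff.2 hxy) 2)).1
      ((le_max_right _ _).trans (hφ.bound i u hu x y (max_le hx hy) hxy))

theorem growth_trunc (hφ : IsLipschitzControl f g φ) {i : Fin m} (hf : f 0 i = 0)
    (hg : g 0 i = 0) {u v : ℝ} (hu : 1 ≤ u) (hv : φ i u ≤ v)
    (x : EuclideanSpace ℝ (Fin n)) :
    ‖f (trunc (truncRadius (φ i) v) x) i‖ ≤ v * ‖trunc (truncRadius (φ i) v) x‖ ∧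
    traceNorm (g (trunc (truncRadius (φ i) v) x) i) ^ 2
      ≤ v * ‖trunc (truncRadius (φ i) v) x‖ ^ 2 := by
  have hz := (enorm_trunc (truncRadius (φ i) v) x).trans_le (min_le_right _ _)
  generalize trunc (truncRadius (φ i) v) x = z at hz ⊢
  have hmax : φ i (max ‖z‖ 1) ≤ v := by
    refine le_of_ofReal_le_truncRadius (hφ.monotoneOn i) (hφ.continuousOn i) (by positivity) ?_
    rw [ENNReal.ofReal_max, ofReal_norm]
    exact max_le hz ((ENNReal.ofReal_le_ofReal hu).trans
      (ofReal_le_truncRadius (zero_le_one.trans hu) hv))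
  have hdrift := hφ.norm_sub_le i (le_max_right ‖z‖ 1) (le_max_left _ _)
    (norm_zero.trans_le (by positivity))
  have hdiff := hφ.traceNorm_sub_sq_le i (le_max_right ‖z‖ 1) (le_max_left _ _)
    (norm_zero.trans_le (by positivity))
  rw [hf, sub_zero, sub_zero] at hdrift
  rw [hg, sub_zero, sub_zero] at hdiff
  exact ⟨hdrift.trans (by gcongr), hdiff.trans (by gcongr)⟩

end IsLipschitzControl

end Truncation

section Measurability

variable {n d m : ℕ} {f : EuclideanSpace ℝ (Fin n) → Fin m → EuclideanSpace ℝ (Fin n)}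
  {g : EuclideanSpace ℝ (Fin n) → Fin m → Matrix (Fin n) (Fin d) ℝ} {φ : Fin m → ℝ → ℝ}

theorem sq_apply_le_traceNorm_sq (A : Matrix (Fin n) (Fin d) ℝ) (i : Fin n) (j : Fin d) :
    A i j ^ 2 ≤ traceNorm A ^ 2 := by
  have hentry : |A i j| ≤ traceNorm A :=
    calc |A i j| = ‖A.toEuclideanLin (EuclideanSpace.single j 1) i‖ := by
          simp [Matrix.toLpLin_apply]
      _ ≤ ‖A.toEuclideanLin (EuclideanSpace.single j 1)‖ := PiLp.norm_apply_le _ i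
      _ ≤ traceNorm A := by simpa using norm_toEuclideanLin_le A (EuclideanSpace.single j 1)
  exact sq_le_sq' (neg_le_of_abs_le hentry) (le_of_abs_le hentry)

theorem continuous_of_norm_sub_sq_le_on_balls {E F : Type*} [SeminormedAddCommGroup E]
    [SeminormedAddCommGroup F] {u : E → F} {C : ℝ → ℝ}
    (h : ∀ N, 1 ≤ N → ∀ x y, ‖x‖ ≤ N → ‖y‖ ≤ N → ‖u x - u y‖ ^ 2 ≤ C N * ‖x - y‖ ^ 2) :
    Continuous u := by
  refine continuous_iff_continuousAt.2 fun x => tendsto_iff_norm_sub_tendsto_zero.2 ?_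
  have hbound : Tendsto (fun y => √(C (‖x‖ + 1) * ‖y - x‖ ^ 2)) (𝓝 x) (𝓝 0) :=
    Continuous.tendsto' (by fun_prop) _ _ (by simp)
  refine squeeze_zero' (Eventually.of_forall fun _ => norm_nonneg _) ?_ hbound
  filter_upwards [continuous_norm.continuousAt.eventually (gt_mem_nhds (lt_add_one ‖x‖))] with y hy
  exact Real.le_sqrt_of_sq_le (h _ (by simp) y x hy.le (by simp))

namespace IsLipschitzControl

theorem continuous_drift (hφ : IsLipschitzControl f g φ) (i : Fin m) :
    Continuous fun x => f x i :=
  continuous_of_norm_sub_sq_le_on_balls (C := fun N => φ i N ^ 2) fun N hN x y hx hy => by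
    rw [← mul_pow]
    exact pow_le_pow_left₀ (norm_nonneg _) (hφ.norm_sub_le i hN hx hy) 2

theorem continuous_diffusion (hφ : IsLipschitzControl f g φ) (i : Fin m) :
    Continuous fun x => g x i :=
  continuous_matrix fun a c => continuous_of_norm_sub_sq_le_on_balls (C := φ i)
    fun N hN x y hx hy => by
      rw [Real.norm_eq_abs, sq_abs]
      exact (sq_apply_le_traceNorm_sq (g x i - g y i) a c).trans
        (hφ.traceNorm_sub_sq_le i hN hx hy)

end IsLipschitzControl

/-- One step `Z̃_k ↦ Z̃_{k+1}` of the truncated Euler-Maruyama recursion in state `i`: truncate to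
radius `φ_i⁻¹(v)`, then apply the Euler-Maruyama step with increment `b`. -/
def truncStep (f : EuclideanSpace ℝ (Fin n) → Fin m → EuclideanSpace ℝ (Fin n))
    (g : EuclideanSpace ℝ (Fin n) → Fin m → Matrix (Fin n) (Fin d) ℝ) (φ : Fin m → ℝ → ℝ)
    (v Δ : ℝ) (i : Fin m) (x : EuclideanSpace ℝ (Fin n)) (b : EuclideanSpace ℝ (Fin d)) :
    EuclideanSpace ℝ (Fin n) :=
  trunc (truncRadius (φ i) v) x + Δ • f (trunc (truncRadius (φ i) v) x) i
    + (g (trunc (truncRadius (φ i) v) x) i).toEuclideanLin b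

theorem IsLipschitzControl.measurable_truncStep (hφ : IsLipschitzControl f g φ) (v Δ : ℝ)
    (i : Fin m) : Measurable (Function.uncurry (truncStep f g φ v Δ i)) := by
  have hstep : Continuous fun z : EuclideanSpace ℝ (Fin n) × EuclideanSpace ℝ (Fin d) =>
      z.1 + Δ • f z.1 i + WithLp.toLp 2 (g z.1 i *ᵥ z.2.ofLp) := by
    have hf := hφ.continuous_drift i
    have hg := hφ.continuous_diffusion i
    fun_prop
  exact hstep.measurable.comp
    (((measurable_trunc _).comp measurable_fst).prodMk measurable_snd)

end Measurability

section DrivenOrbit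

variable {Ω ι E Y : Type*}

/-- The orbit of `x₀` under the recursion `X_{k+1} = Φ (r_k) X_k (b_k)` driven by the input
sequences `r` and `b`; it serves to separate the switching sequence `r` from the noise `b`. -/
def drivenOrbit (Φ : ι → E → Y → E) (x₀ : E) (r : ℕ → ι) (b : ℕ → Y) : ℕ → E
  | 0 => x₀
  | k + 1 => Φ (r k) (drivenOrbit Φ x₀ r b k) (b k)

variable [MeasurableSpace Ω] [MeasurableSpace E] [MeasurableSpace Y] {P : Measure Ω}
  [MeasurableSpace ι] [Countable ι] [MeasurableSingletonClass ι]
  {Φ : ι → E → Y → E} {ν : Measure Y} {V : E → ℝ≥0∞} {a : ι → ℝ≥0∞} {ξ : ℕ → Ω → Y}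

theorem measurable_drivenOrbit (hΦ : ∀ i, Measurable (Function.uncurry (Φ i))) (x₀ : E)
    {s : ℕ → Ω → ι} {k : ℕ} (hs : ∀ j < k, Measurable (s j)) (hξ : ∀ j < k, Measurable (ξ j)) :
    Measurable fun ω => drivenOrbit Φ x₀ (fun j => s j ω) (fun j => ξ j ω) k := by
  have hΦ' : Measurable fun y : ι × E × Y => Function.uncurry (Φ y.1) y.2 :=
    measurable_from_prod_countable_right hΦ
  induction k with
  | zero => exact measurable_const
  | succ k ih =>
    exact hΦ'.comp ((hs k k.lt_succ_self).prodMk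
      ((ih (fun j hj => hs j (hj.trans k.lt_succ_self))
        fun j hj => hξ j (hj.trans k.lt_succ_self)).prodMk (hξ k k.lt_succ_self)))

theorem indepFun_drivenOrbit (hΦ : ∀ i, Measurable (Function.uncurry (Φ i)))
    (hξ : ∀ k, Measurable (ξ k)) (hind : iIndepFun ξ P) (x₀ : E) (r : ℕ → ι) (k : ℕ) :
    IndepFun (fun ω => drivenOrbit Φ x₀ r (fun j => ξ j ω) k) (ξ k) P := by
  set past : MeasurableSpace Ω := ⨆ j ∈ Set.Iio k, MeasurableSpace.comap (ξ j) inferInstance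
  have hpast : Indep past (MeasurableSpace.comap (ξ k) inferInstance) P := by
    have h := indep_iSup_of_disjoint (fun k => (hξ k).comap_le) hind
      (S := Set.Iio k) (T := {k}) (by simp)
    rwa [iSup_singleton] at h
  have hξ_past : ∀ j < k, Measurable[past] (ξ j) := fun j hj => Measurable.of_comap_le <|
    le_biSup (fun j => MeasurableSpace.comap (ξ j) inferInstance) (Set.mem_Iio.2 hj)
  have hmeas : Measurable[past] fun ω => drivenOrbit Φ x₀ r (fun j => ξ j ω) k :=
    measurable_drivenOrbit hΦ x₀ (fun _ _ => measurable_const) hξ_past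
  exact indep_of_indep_of_le_left hpast hmeas.comap_le

theorem lintegral_prodMk_of_indepFun [IsFiniteMeasure P] {X : Ω → E} {W : Ω → Y}
    (hX : Measurable X) (hW : Measurable W) (h : IndepFun X W P) {F : E × Y → ℝ≥0∞}
    (hF : Measurable F) :
    ∫⁻ ω, F (X ω, W ω) ∂P = ∫⁻ ω, ∫⁻ y, F (X ω, y) ∂(P.map W) ∂P := by
  rw [← lintegral_map hF (hX.prodMk hW),
    (indepFun_iff_map_prod_eq_prod_map_map hX.aemeasurable hW.aemeasurable).1 h,
    lintegral_prod _ hF.aemeasurable, lintegral_map hF.lintegral_prod_right' hX]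

theorem lintegral_drivenOrbit_le [IsProbabilityMeasure P]
    (hΦ : ∀ i, Measurable (Function.uncurry (Φ i))) (hξ : ∀ k, Measurable (ξ k))
    (hind : iIndepFun ξ P) (hlaw : ∀ k, P.map (ξ k) = ν) (hV : Measurable V)
    (hstep : ∀ i x, ∫⁻ y, V (Φ i x y) ∂ν ≤ a i * V x) (x₀ : E) (r : ℕ → ι) (k : ℕ) :
    ∫⁻ ω, V (drivenOrbit Φ x₀ r (fun j => ξ j ω) k) ∂P
      ≤ (∏ j ∈ Finset.range k, a (r j)) * V x₀ := by
  induction k with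
  | zero => simp [drivenOrbit]
  | succ k ih =>
    have hX : Measurable fun ω => drivenOrbit Φ x₀ r (fun j => ξ j ω) k :=
      measurable_drivenOrbit hΦ x₀ (fun _ _ => measurable_const) fun j _ => hξ j
    calc ∫⁻ ω, V (Φ (r k) (drivenOrbit Φ x₀ r (fun j => ξ j ω) k) (ξ k ω)) ∂P
        = ∫⁻ ω, ∫⁻ y, V (Φ (r k) (drivenOrbit Φ x₀ r (fun j => ξ j ω) k) y) ∂ν ∂P := by
          rw [← hlaw k]
          exact lintegral_prodMk_of_indepFun hX (hξ k)
            (indepFun_drivenOrbit hΦ hξ hind x₀ r k) (hV.comp (hΦ (r k)))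
      _ ≤ ∫⁻ ω, a (r k) * V (drivenOrbit Φ x₀ r (fun j => ξ j ω) k) ∂P :=
          lintegral_mono fun ω => hstep _ _
      _ = a (r k) * ∫⁻ ω, V (drivenOrbit Φ x₀ r (fun j => ξ j ω) k) ∂P :=
          lintegral_const_mul _ (hV.comp hX)
      _ ≤ a (r k) * ((∏ j ∈ Finset.range k, a (r j)) * V x₀) := by gcongr
      _ = (∏ j ∈ Finset.range (k + 1), a (r j)) * V x₀ := by
          rw [Finset.prod_range_succ_comm, mul_assoc]

theorem lintegral_drivenOrbit_le_of_indepFun [IsProbabilityMeasure P]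
    (hΦ : ∀ i, Measurable (Function.uncurry (Φ i))) (hξ : ∀ k, Measurable (ξ k))
    (hind : iIndepFun ξ P) (hlaw : ∀ k, P.map (ξ k) = ν) (hV : Measurable V)
    (hstep : ∀ i x, ∫⁻ y, V (Φ i x y) ∂ν ≤ a i * V x) {s : ℕ → Ω → ι}
    (hs : ∀ k, Measurable (s k)) (hsξ : IndepFun (fun ω k => s k ω) (fun ω k => ξ k ω) P)
    (x₀ : E) (k : ℕ) :
    ∫⁻ ω, V (drivenOrbit Φ x₀ (fun j => s j ω) (fun j => ξ j ω) k) ∂P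
      ≤ (∫⁻ ω, ∏ j ∈ Finset.range k, a (s j ω) ∂P) * V x₀ := by
  have hF : Measurable fun z : (ℕ → ι) × (ℕ → Y) => V (drivenOrbit Φ x₀ z.1 z.2 k) :=
    hV.comp (measurable_drivenOrbit hΦ x₀ (fun _ _ => by fun_prop) fun _ _ => by fun_prop)
  have hξ' := measurable_pi_lambda (fun ω k => ξ k ω) hξ
  have hprod : Measurable fun ω => ∏ j ∈ Finset.range k, a (s j ω) :=
    Finset.measurable_prod _ fun j _ => (measurable_of_countable a).comp (hs j)
  calc ∫⁻ ω, V (drivenOrbit Φ x₀ (fun j => s j ω) (fun j => ξ j ω) k) ∂P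
      = ∫⁻ ω, ∫⁻ b, V (drivenOrbit Φ x₀ (fun j => s j ω) b k) ∂P.map (fun ω k => ξ k ω) ∂P :=
        lintegral_prodMk_of_indepFun (measurable_pi_lambda _ hs) hξ' hsξ hF
    _ = ∫⁻ ω, ∫⁻ ω', V (drivenOrbit Φ x₀ (fun j => s j ω) (fun j => ξ j ω') k) ∂P ∂P := by
        congr! 2 with ω
        exact lintegral_map (hF.comp measurable_prodMk_left) hξ'
    _ ≤ ∫⁻ ω, (∏ j ∈ Finset.range k, a (s j ω)) * V x₀ ∂P :=
        lintegral_mono fun ω => lintegral_drivenOrbit_le hΦ hξ hind hlaw hV hstep x₀ _ k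
    _ = (∫⁻ ω, ∏ j ∈ Finset.range k, a (s j ω) ∂P) * V x₀ := lintegral_mul_const _ hprod

end DrivenOrbit

section Increments

variable {Ω : Type*} [MeasurableSpace Ω] {P : Measure Ω}

theorem iIndepFun_curry {ι κ E : Type*} [MeasurableSpace E] {X : ι → κ → Ω → E}
    (hX : ∀ i j, Measurable (X i j)) (h : iIndepFun (fun q : ι × κ => X q.1 q.2) P) :
    iIndepFun (fun i ω j => X i j ω) P := by
  have := h.isProbabilityMeasure
  have (i : ι) (j : κ) : IsProbabilityMeasure (P.map (X i j)) :=
    Measure.isProbabilityMeasure_map (hX i j).aemeasurable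
  have hrow (i : ι) : iIndepFun (X i) P := h.precomp (g := Prod.mk i) (Prod.mk_right_injective i)
  rw [iIndepFun_iff_map_fun_eq_infinitePi_map (by fun_prop)] at h ⊢
  calc P.map (fun ω i j => X i j ω)
      = (P.map fun ω (q : ι × κ) => X q.1 q.2 ω).map (MeasurableEquiv.curry ι κ E) := by
        rw [Measure.map_map (by fun_prop) (by fun_prop)]
        rfl
    _ = Measure.infinitePi fun i => Measure.infinitePi fun j => P.map (X i j) := by
        rw [h]
        exact Measure.infinitePi_map_curry fun i j => P.map (X i j)
    _ = Measure.infinitePi fun i => P.map fun ω j => X i j ω := by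
        congr! with i
        exact ((iIndepFun_iff_map_fun_eq_infinitePi_map (hX i)).1 (hrow i)).symm

variable {d : ℕ} {B : ℝ≥0 → Ω → EuclideanSpace ℝ (Fin d)}

theorem map_smul_stdGaussian (τ : ℝ≥0) :
    (stdGaussian (EuclideanSpace ℝ (Fin d))).map (√(τ : ℝ) • ·)
      = (Measure.pi fun _ : Fin d => gaussianReal 0 τ).map (WithLp.toLp 2) := by
  have hcoord : (gaussianReal 0 1).map (√(τ : ℝ) * ·) = gaussianReal 0 τ := by
    rw [gaussianReal_map_const_mul]
    congr 1
    · simp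
    · ext
      simp
  have hpi := Measure.pi_map_pi (μ := fun _ : Fin d => gaussianReal 0 1)
    (f := fun _ => (√(τ : ℝ) * ·)) fun _ => by fun_prop
  simp only [hcoord] at hpi
  rw [← map_pi_eq_stdGaussian, ← hpi, Measure.map_map (by fun_prop) (by fun_prop),
    Measure.map_map (by fun_prop) (by fun_prop)]
  rfl

/-- The increment of `B` over the `k`-th interval of length `τ`. -/
def increment (B : ℝ≥0 → Ω → EuclideanSpace ℝ (Fin d)) (τ : ℝ≥0) (k : ℕ) (ω : Ω) :
    EuclideanSpace ℝ (Fin d) :=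
  B ((k + 1) * τ) ω - B (k * τ) ω

namespace IsBrownianMotion

theorem measurable_increment (hB : IsBrownianMotion P B) (τ : ℝ≥0) (k : ℕ) :
    Measurable (increment B τ k) :=
  (hB.measurable _).sub (hB.measurable _)

theorem iIndepFun_increment_apply (hB : IsBrownianMotion P B) (τ : ℝ≥0) :
    iIndepFun (fun (q : Fin d × ℕ) ω => increment B τ q.2 ω q.1) P := by
  have hmeas := hB.measurable_increment τ
  refine iIndepFun_uncurry' (X := fun a k ω => increment B τ k ω a)
    (fun a k => by fun_prop) ?_ fun a => ?_
  · exact hB.indep.comp (fun _ path (k : ℕ) => path ((k + 1) * τ) - path (k * τ))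
      fun _ => by fun_prop
  · have h := (hB.coord a).hasIndepIncrements.nat (t := fun k : ℕ => (k : ℝ≥0) * τ)
      fun i j hij => by dsimp only; gcongr
    simpa only [increment, PiLp.sub_apply, Nat.cast_add, Nat.cast_one] using h

theorem iIndepFun_increment (hB : IsBrownianMotion P B) (τ : ℝ≥0) :
    iIndepFun (increment B τ) P := by
  have hmeas := hB.measurable_increment τ
  have h := iIndepFun_curry (X := fun k a ω => increment B τ k ω a) (fun k a => by fun_prop)
    ((hB.iIndepFun_increment_apply τ).precomp (g := Prod.swap) Prod.swap_injective)
  exact h.comp (fun _ => WithLp.toLp 2) fun _ => by fun_prop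

theorem hasLaw_increment_apply (hB : IsBrownianMotion P B) (τ : ℝ≥0) (k : ℕ) (a : Fin d) :
    HasLaw (fun ω => increment B τ k ω a) (gaussianReal 0 τ) P := by
  have h : HasLaw (fun ω => increment B τ k ω a) _ P :=
    (hB.coord a).hasLaw_sub ((k + 1) * τ) (k * τ)
  convert h using 2
  ext
  simp [add_mul]

theorem map_increment (hB : IsBrownianMotion P B) (τ : ℝ≥0) (k : ℕ) :
    P.map (increment B τ k) = (stdGaussian (EuclideanSpace ℝ (Fin d))).map (√(τ : ℝ) • ·) := by
  have hmeas := hB.measurable_increment τ k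
  have hind : iIndepFun (fun a ω => increment B τ k ω a) P :=
    (hB.iIndepFun_increment_apply τ).precomp (g := fun a => (a, k)) (Prod.mk_left_injective k)
  have := hind.isProbabilityMeasure
  have hpi := (iIndepFun_iff_map_fun_eq_pi_map fun a => by fun_prop).1 hind
  simp only [(hB.hasLaw_increment_apply τ k _).map_eq] at hpi
  rw [map_smul_stdGaussian, ← hpi, Measure.map_map (by fun_prop) (by fun_prop)]
  rfl

end IsBrownianMotion

end Increments

section Chain

variable {Ω : Type*} [MeasurableSpace Ω] {P : Measure Ω} {m : ℕ}
  {Γ : Matrix (Fin m) (Fin m) ℝ} {ℓ : Fin m} {r : ℝ≥0 → Ω → Fin m}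

/-- The path of the chain observed at the first `k + 1` grid points. -/
def gridPath (r : ℝ≥0 → Ω → Fin m) (τ : ℝ≥0) (k : ℕ) (ω : Ω) (j : Fin (k + 1)) : Fin m :=
  r (j * τ) ω

namespace IsMarkovChain

theorem measurable_gridPath (hr : IsMarkovChain P Γ ℓ r) (τ : ℝ≥0) (k : ℕ) :
    Measurable (gridPath r τ k) :=
  measurable_pi_lambda _ fun _ => hr.measurable _

theorem measureReal_gridPath_eq (hr : IsMarkovChain P Γ ℓ r) (τ : ℝ≥0) (k : ℕ)
    (c : Fin (k + 1) → Fin m) :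
    P.real {ω | gridPath r τ k ω = c} = P.real {ω | r 0 ω = c 0} *
      ∏ j : Fin k, NormedSpace.exp ((τ : ℝ) • Γ) (c j.castSucc) (c j.succ) := by
  have hmono : Monotone fun j : Fin (k + 1) => ((j : ℕ) : ℝ≥0) * τ := fun i j hij => by
    dsimp only
    gcongr
    exact hij
  have hset : {ω | gridPath r τ k ω = c} = {ω | ∀ j : Fin (k + 1), r ((j : ℕ) * τ) ω = c j} :=
    Set.ext fun ω => funext_iff
  rw [hset, hr.finite_dim k _ hmono c]
  simp [add_mul]

theorem measureReal_gridPath_eq_snoc (hr : IsMarkovChain P Γ ℓ r) (τ : ℝ≥0) (k : ℕ)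
    (c : Fin (k + 1) → Fin m) (i : Fin m) :
    P.real {ω | gridPath r τ (k + 1) ω = Fin.snoc c i} =
      P.real {ω | gridPath r τ k ω = c} * NormedSpace.exp ((τ : ℝ) • Γ) (c (Fin.last k)) i := by
  have hzero : (Fin.snoc c i : Fin (k + 2) → Fin m) 0 = c 0 :=
    Fin.snoc_castSucc (α := fun _ => Fin m) i c 0
  rw [hr.measureReal_gridPath_eq, hr.measureReal_gridPath_eq, Fin.prod_univ_castSucc, hzero,
    ← mul_assoc]
  simp only [Fin.succ_castSucc, Fin.snoc_castSucc, Fin.succ_last, Fin.snoc_last]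

theorem integrable_gridPath [IsFiniteMeasure P] (hr : IsMarkovChain P Γ ℓ r) (τ : ℝ≥0) (k : ℕ)
    (F : (Fin (k + 1) → Fin m) → ℝ) : Integrable (fun ω => F (gridPath r τ k ω)) P :=
  Integrable.of_finite.comp_measurable (hr.measurable_gridPath τ k)

theorem integral_gridPath [IsFiniteMeasure P] (hr : IsMarkovChain P Γ ℓ r) (τ : ℝ≥0) (k : ℕ)
    (F : (Fin (k + 1) → Fin m) → ℝ) :
    ∫ ω, F (gridPath r τ k ω) ∂P = ∑ c, P.real {ω | gridPath r τ k ω = c} * F c := by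
  have hmeas := hr.measurable_gridPath τ k
  rw [← integral_map hmeas.aemeasurable (measurable_of_finite F).aestronglyMeasurable,
    integral_fintype Integrable.of_finite]
  congr! with c
  rw [map_measureReal_apply hmeas (measurableSet_singleton c)]
  rfl

theorem integral_gridPath_mul [IsFiniteMeasure P] (hr : IsMarkovChain P Γ ℓ r) (τ : ℝ≥0) (k : ℕ)
    (F : (Fin (k + 1) → Fin m) → ℝ) (ζ : Fin m → ℝ) :
    ∫ ω, F (gridPath r τ k ω) * ζ (r ((k + 1 : ℕ) * τ) ω) ∂P =
      ∫ ω, F (gridPath r τ k ω) * (NormedSpace.exp ((τ : ℝ) • Γ) *ᵥ ζ) (r (k * τ) ω) ∂P := by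
  calc ∫ ω, F (gridPath r τ k ω) * ζ (r ((k + 1 : ℕ) * τ) ω) ∂P
      = ∑ c, P.real {ω | gridPath r τ (k + 1) ω = c} *
          (F (Fin.init c) * ζ (c (Fin.last (k + 1)))) :=
        hr.integral_gridPath τ (k + 1) fun c => F (Fin.init c) * ζ (c (Fin.last (k + 1)))
    _ = ∑ c : Fin (k + 1) → Fin m, ∑ i, P.real {ω | gridPath r τ (k + 1) ω = Fin.snoc c i} *
          (F c * ζ i) := by
        rw [← (Fin.snocEquiv fun _ => Fin m).sum_comp, Fintype.sum_prod_type_right]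
        simp [Fin.snocEquiv]
    _ = ∑ c, P.real {ω | gridPath r τ k ω = c} *
          (F c * (NormedSpace.exp ((τ : ℝ) • Γ) *ᵥ ζ) (c (Fin.last k))) := by
        simp only [hr.measureReal_gridPath_eq_snoc, Matrix.mulVec, dotProduct, Finset.mul_sum]
        congr! 2
        ring
    _ = _ := (hr.integral_gridPath τ k fun c =>
        F c * (NormedSpace.exp ((τ : ℝ) • Γ) *ᵥ ζ) (c (Fin.last k))).symm

theorem integrable_prod_mul [IsFiniteMeasure P] (hr : IsMarkovChain P Γ ℓ r) (τ : ℝ≥0)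
    (a F : Fin m → ℝ) (k : ℕ) :
    Integrable (fun ω => (∏ j ∈ Finset.range k, a (r (j * τ) ω)) * F (r (k * τ) ω)) P := by
  simp only [Finset.prod_range fun j => a (r (j * τ) _)]
  exact hr.integrable_gridPath τ k
    fun c => (∏ j : Fin k, a (c j.castSucc)) * F (c (Fin.last k))

theorem integral_prod_mul_le [IsFiniteMeasure P] (hr : IsMarkovChain P Γ ℓ r) (τ : ℝ≥0)
    {a ζ : Fin m → ℝ} {κ : ℝ} (ha : ∀ i, 0 ≤ a i) (hκ : 0 ≤ κ)
    (hζ : ∀ i, a i * (NormedSpace.exp ((τ : ℝ) • Γ) *ᵥ ζ) i ≤ ζ i * κ) (k : ℕ) :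
    ∫ ω, (∏ j ∈ Finset.range k, a (r (j * τ) ω)) * ζ (r (k * τ) ω) ∂P
      ≤ (∫ ω, ζ (r 0 ω) ∂P) * κ ^ k := by
  induction k with
  | zero => simp
  | succ k ih =>
    set A : Ω → ℝ := fun ω => ∏ j ∈ Finset.range k, a (r (j * τ) ω)
    have hA : ∀ ω, 0 ≤ A ω := fun ω => Finset.prod_nonneg fun j _ => ha _
    calc ∫ ω, (∏ j ∈ Finset.range (k + 1), a (r (j * τ) ω)) * ζ (r ((k + 1 : ℕ) * τ) ω) ∂P
        = ∫ ω, (∏ j ∈ Finset.range (k + 1), a (r (j * τ) ω)) *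
            (NormedSpace.exp ((τ : ℝ) • Γ) *ᵥ ζ) (r (k * τ) ω) ∂P := by
          simp only [Finset.prod_range fun j => a (r (j * τ) _)]
          exact hr.integral_gridPath_mul τ k (fun c => ∏ j, a (c j)) ζ
      _ = ∫ ω, A ω * (a (r (k * τ) ω) * (NormedSpace.exp ((τ : ℝ) • Γ) *ᵥ ζ) (r (k * τ) ω)) ∂P := by
          simp only [Finset.prod_range_succ, mul_assoc, A]
      _ ≤ ∫ ω, A ω * (ζ (r (k * τ) ω) * κ) ∂P :=
          integral_mono
            (hr.integrable_prod_mul τ a (fun i => a i * (NormedSpace.exp ((τ : ℝ) • Γ) *ᵥ ζ) i) k)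
            (hr.integrable_prod_mul τ a (fun i => ζ i * κ) k)
            fun ω => mul_le_mul_of_nonneg_left (hζ _) (hA ω)
      _ = (∫ ω, A ω * ζ (r (k * τ) ω) ∂P) * κ := by
          simp only [← mul_assoc, integral_mul_const]
      _ ≤ (∫ ω, ζ (r 0 ω) ∂P) * κ ^ (k + 1) := by
          rw [pow_succ, ← mul_assoc]
          gcongr

theorem exists_lintegral_prod_le [IsFiniteMeasure P] (hr : IsMarkovChain P Γ ℓ r) (τ : ℝ≥0)
    {a ζ : Fin m → ℝ} {κ : ℝ} (ha : ∀ i, 0 ≤ a i) (hκ : 0 ≤ κ) (hζ_pos : ∀ i, 0 < ζ i)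
    (hζ : ∀ i, a i * (NormedSpace.exp ((τ : ℝ) • Γ) *ᵥ ζ) i ≤ ζ i * κ) :
    ∃ D : ℝ≥0∞, D ≠ ⊤ ∧ ∀ k : ℕ,
      ∫⁻ ω, ∏ j ∈ Finset.range k, ENNReal.ofReal (a (r (j * τ) ω)) ∂P
        ≤ D * ENNReal.ofReal κ ^ k := by
  obtain ⟨M, hM⟩ : ∃ M, ∀ i, (ζ i)⁻¹ ≤ M :=
    (Set.finite_range fun i => (ζ i)⁻¹).bddAbove.imp fun _ h i => h ⟨i, rfl⟩
  have hM_nonneg : 0 ≤ M := (inv_nonneg.2 (hζ_pos ℓ).le).trans (hM ℓ)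
  refine ⟨ENNReal.ofReal ((∫ ω, ζ (r 0 ω) ∂P) * M), ENNReal.ofReal_ne_top, fun k => ?_⟩
  have hnonneg (ω : Ω) : 0 ≤ ∏ j ∈ Finset.range k, a (r (j * τ) ω) :=
    Finset.prod_nonneg fun j _ => ha _
  have hint : Integrable (fun ω => ∏ j ∈ Finset.range k, a (r (j * τ) ω)) P := by
    simpa only [Pi.one_apply, mul_one] using hr.integrable_prod_mul τ a 1 k
  have hreal : ∫ ω, ∏ j ∈ Finset.range k, a (r (j * τ) ω) ∂P ≤ (∫ ω, ζ (r 0 ω) ∂P) * M * κ ^ k :=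
    calc ∫ ω, ∏ j ∈ Finset.range k, a (r (j * τ) ω) ∂P
        ≤ ∫ ω, (∏ j ∈ Finset.range k, a (r (j * τ) ω)) * ζ (r (k * τ) ω) * M ∂P := by
          refine integral_mono hint ((hr.integrable_prod_mul τ a ζ k).mul_const M) fun ω => ?_
          dsimp only
          rw [mul_assoc]
          refine le_mul_of_one_le_right (hnonneg ω) ?_
          exact (inv_le_iff_one_le_mul₀' (hζ_pos _)).1 (hM _)
      _ ≤ (∫ ω, ζ (r 0 ω) ∂P) * κ ^ k * M := by
          rw [integral_mul_const]
          exact mul_le_mul_of_nonneg_right (hr.integral_prod_mul_le τ ha hκ hζ k) hM_nonneg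
      _ = _ := by ring
  have hofReal (ω : Ω) : ∏ j ∈ Finset.range k, ENNReal.ofReal (a (r (j * τ) ω)) =
      ENNReal.ofReal (∏ j ∈ Finset.range k, a (r (j * τ) ω)) :=
    (ENNReal.ofReal_prod_of_nonneg fun j _ => ha _).symm
  simp only [hofReal]
  rw [← ofReal_integral_eq_lintegral_ofReal hint (Eventually.of_forall hnonneg),
    ← ENNReal.ofReal_pow hκ, ← ENNReal.ofReal_mul' (pow_nonneg hκ k)]
  exact ENNReal.ofReal_le_ofReal hreal

end IsMarkovChain

end Chain

section Rates

variable {Ω : Type*} [MeasurableSpace Ω] {P : Measure Ω}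

theorem tsum_ofReal_exp_mul_ne_top {u : ℕ → ℝ≥0∞} {A : ℝ≥0∞} {κ κ' Δ : ℝ} (hA : A ≠ ⊤)
    (hΔ : 0 < Δ) (hκ : κ < κ') (hu : ∀ k, u k ≤ A * ENNReal.ofReal (Real.exp (-κ' * Δ)) ^ k) :
    ∑' k : ℕ, ENNReal.ofReal (Real.exp (κ * (k * Δ))) * u k ≠ ⊤ := by
  set q : ℝ≥0∞ := ENNReal.ofReal (Real.exp ((κ - κ') * Δ))
  have hq : q < 1 :=
    ENNReal.ofReal_lt_one.2 (Real.exp_lt_one_iff.2 (mul_neg_of_neg_of_pos (sub_neg.2 hκ) hΔ))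
  have hle (k : ℕ) : ENNReal.ofReal (Real.exp (κ * (k * Δ))) * u k ≤ A * q ^ k := by
    have hpow : ENNReal.ofReal (Real.exp (κ * (k * Δ))) * ENNReal.ofReal (Real.exp (-κ' * Δ)) ^ k
        = q ^ k := by
      simp only [q, ← ENNReal.ofReal_pow (Real.exp_pos _).le, ← Real.exp_nat_mul]
      rw [← ENNReal.ofReal_mul (Real.exp_pos _).le, ← Real.exp_add]
      ring_nf
    calc _ ≤ ENNReal.ofReal (Real.exp (κ * (k * Δ))) *
          (A * ENNReal.ofReal (Real.exp (-κ' * Δ)) ^ k) := by gcongr; exact hu k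
      _ = A * q ^ k := by rw [← hpow]; ring
  refine ne_top_of_le_ne_top ?_ (ENNReal.tsum_le_tsum hle)
  rw [ENNReal.tsum_mul_left, ENNReal.tsum_geometric]
  exact ENNReal.mul_ne_top hA (ENNReal.inv_ne_top.2 (tsub_pos_of_lt hq).ne')

theorem limsup_log_div_le {u : ℕ → ℝ≥0∞} {κ Δ : ℝ} (hΔ : 0 < Δ)
    (hu : Tendsto (fun k : ℕ => ENNReal.ofReal (Real.exp (κ * (k * Δ))) * u k) atTop (𝓝 0)) :
    limsup (fun k : ℕ => ENNReal.log (u k) / ((k * Δ : ℝ) : EReal)) atTop ≤ ((-κ : ℝ) : EReal) := by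
  refine limsup_le_of_le (by isBoundedDefault) ?_
  filter_upwards [hu.eventually (gt_mem_nhds one_pos), eventually_gt_atTop 0] with k hk hk_pos
  have hpos : 0 < (k : ℝ) * Δ := by positivity
  have hle : u k ≤ ENNReal.ofReal (Real.exp (-κ * (k * Δ))) := by
    rw [neg_mul, Real.exp_neg, ENNReal.ofReal_inv_of_pos (Real.exp_pos _),
      ENNReal.le_inv_iff_mul_le, mul_comm]
    exact hk.le
  rw [EReal.div_le_iff_le_mul (by exact_mod_cast hpos) (EReal.coe_ne_top _)]
  calc ENNReal.log (u k) ≤ ENNReal.log (ENNReal.ofReal (Real.exp (-κ * (k * Δ)))) :=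
        ENNReal.log_monotone hle
    _ = ((k * Δ : ℝ) : EReal) * ((-κ : ℝ) : EReal) := by
        rw [ENNReal.log_ofReal_of_pos (Real.exp_pos _), Real.log_exp, EReal.coe_mul, mul_comm]

theorem ae_tendsto_zero_of_tsum_lintegral_ne_top {w : ℕ → Ω → ℝ≥0∞}
    (hw : ∀ k, AEMeasurable (w k) P) (hsum : ∑' k, ∫⁻ ω, w k ω ∂P ≠ ⊤) :
    ∀ᵐ ω ∂P, Tendsto (fun k => w k ω) atTop (𝓝 0) := by
  rw [← lintegral_tsum hw] at hsum
  filter_upwards [ae_lt_top' (AEMeasurable.tsum hw) hsum] with ω hω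
  exact ENNReal.tendsto_atTop_zero_of_tsum_ne_top hω.ne

theorem ae_limsup_log_div_le {X : ℕ → Ω → ℝ≥0∞} (hX : ∀ k, Measurable (X k)) {κ Δ p : ℝ}
    (hΔ : 0 < Δ) (hp : 0 < p)
    (hsum : ∑' k : ℕ, ENNReal.ofReal (Real.exp (κ * (k * Δ))) * ∫⁻ ω, X k ω ^ p ∂P ≠ ⊤) :
    ∀ᵐ ω ∂P, limsup (fun k : ℕ => ENNReal.log (X k ω) / ((k * Δ : ℝ) : EReal)) atTop
      ≤ ((-(κ / p) : ℝ) : EReal) := by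
  have hXp (k : ℕ) : Measurable fun ω => X k ω ^ p := (hX k).pow_const p
  simp only [← lintegral_const_mul _ (hXp _)] at hsum
  filter_upwards [ae_tendsto_zero_of_tsum_lintegral_ne_top
    (fun k => ((hXp k).const_mul _).aemeasurable) hsum] with ω hω
  refine limsup_log_div_le hΔ ?_
  have hroot := ((ENNReal.continuous_rpow_const (y := p⁻¹)).tendsto 0).comp hω
  rw [ENNReal.zero_rpow_of_pos (inv_pos.2 hp)] at hroot
  refine hroot.congr fun k => ?_
  rw [Function.comp_apply, ENNReal.mul_rpow_of_nonneg _ _ (inv_pos.2 hp).le,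
    ENNReal.rpow_rpow_inv hp.ne', ENNReal.ofReal_rpow_of_pos (Real.exp_pos _), ← Real.exp_mul]
  congr 3
  ring

end Rates

section Scheme

variable {Ω : Type*} [MeasurableSpace Ω] {P : Measure Ω} {n d m : ℕ}
  {B : ℝ≥0 → Ω → EuclideanSpace ℝ (Fin d)}
  {f : EuclideanSpace ℝ (Fin n) → Fin m → EuclideanSpace ℝ (Fin n)}
  {g : EuclideanSpace ℝ (Fin n) → Fin m → Matrix (Fin n) (Fin d) ℝ}
  {φ : Fin m → ℝ → ℝ} {h : ℝ → ℝ} {x₀ : EuclideanSpace ℝ (Fin n)}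
  {Γ : Matrix (Fin m) (Fin m) ℝ} {ℓ : Fin m} {r : ℝ≥0 → Ω → Fin m}

theorem preScheme_eq_drivenOrbit (f : EuclideanSpace ℝ (Fin n) → Fin m → EuclideanSpace ℝ (Fin n))
    (g : EuclideanSpace ℝ (Fin n) → Fin m → Matrix (Fin n) (Fin d) ℝ) (φ : Fin m → ℝ → ℝ)
    (h : ℝ → ℝ) (x₀ : EuclideanSpace ℝ (Fin n)) (Δ : ℝ) (s : ℕ → Fin m)
    (b : ℕ → EuclideanSpace ℝ (Fin d)) (k : ℕ) :
    preScheme f g φ h x₀ Δ s b k = drivenOrbit (truncStep f g φ (h Δ) Δ) x₀ s b k := by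
  induction k with
  | zero => rfl
  | succ k ih => rw [preScheme, drivenOrbit, ih]; rfl

theorem scheme_eq_trunc_drivenOrbit {Ω : Type*}
    (f : EuclideanSpace ℝ (Fin n) → Fin m → EuclideanSpace ℝ (Fin n))
    (g : EuclideanSpace ℝ (Fin n) → Fin m → Matrix (Fin n) (Fin d) ℝ) (φ : Fin m → ℝ → ℝ)
    (h : ℝ → ℝ) (x₀ : EuclideanSpace ℝ (Fin n)) (r : ℝ≥0 → Ω → Fin m)
    (B : ℝ≥0 → Ω → EuclideanSpace ℝ (Fin d)) (Δ : ℝ) (k : ℕ) (ω : Ω) :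
    scheme f g φ h x₀ r B Δ k ω = trunc (truncRadius (φ (r (k * Δ.toNNReal) ω)) (h Δ))
      (drivenOrbit (truncStep f g φ (h Δ) Δ) x₀ (fun j => r (j * Δ.toNNReal) ω)
        (fun j => increment B Δ.toNNReal j ω) k) := by
  rw [scheme, preScheme_eq_drivenOrbit]
  rfl

theorem measurable_scheme (hB : IsBrownianMotion P B) (hφ : IsLipschitzControl f g φ)
    (hr : ∀ t, Measurable (r t)) (h : ℝ → ℝ) (x₀ : EuclideanSpace ℝ (Fin n)) (Δ : ℝ) (k : ℕ) :
    Measurable (scheme f g φ h x₀ r B Δ k) := by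
  have htrunc (c : Fin m → ℝ≥0∞) : Measurable fun z : Fin m × EuclideanSpace ℝ (Fin n) =>
      trunc (c z.1) z.2 :=
    measurable_from_prod_countable_right fun i => measurable_trunc (c i)
  have horbit := measurable_drivenOrbit (hφ.measurable_truncStep (h Δ) Δ) x₀
    (s := fun j => r (j * Δ.toNNReal)) (ξ := increment B Δ.toNNReal) (k := k)
    (fun j _ => hr _) fun j _ => hB.measurable_increment _ _
  have hmeas := (htrunc fun i => truncRadius (φ i) (h Δ)).comp
    ((hr (k * Δ.toNNReal)).prodMk horbit)
  exact funext (scheme_eq_trunc_drivenOrbit f g φ h x₀ r B Δ k) ▸ hmeas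

theorem exists_lintegral_truncStep_le {R : Matrix (Fin n) (Fin n) ℝ} (hR : IsUnit R)
    {β : Fin m → ℝ} {ρ : ℝ} (hstab : StabilityAssumption f g (Rᵀ * R) β ρ)
    (hφ : IsLipschitzControl f g φ) (hh : IsTruncationLevel f g φ x₀ h)
    {p : ℝ} (hp : 0 < p) (hp_le : p ≤ ρ) :
    ∃ C θ : ℝ, 0 < θ ∧ ∀ Δ ∈ Set.Ioc (0 : ℝ) 1, ∀ i x,
      ∫⁻ b, ‖R.toEuclideanLin (truncStep f g φ (h Δ) Δ i x b)‖ₑ ^ p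
          ∂(stdGaussian (EuclideanSpace ℝ (Fin d))).map (√Δ • ·)
        ≤ ENNReal.ofReal (Real.exp (p / 2 * β i * Δ + C * Δ ^ (1 + 2 * θ)))
          * ‖R.toEuclideanLin x‖ₑ ^ p := by
  obtain ⟨θ, hθ, -, K, hK, hrate⟩ := hh.rate
  obtain ⟨C, hC⟩ := exists_lintegral_enorm_step_le (d := d) hR hp hp_le hK.le hθ
  refine ⟨C, θ, hθ, fun Δ hΔ i x => ?_⟩
  have hlevel : φ i (max ‖x₀‖ 1) ≤ h Δ := hh.range Δ hΔ i
  have hlevel_nonneg : 0 ≤ h Δ := (hφ.nonneg i _ (by positivity)).trans hlevel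
  obtain ⟨hdrift, hdiff⟩ :=
    hφ.growth_trunc (hstab.f_zero i) (hstab.g_zero i) (le_max_right _ _) hlevel x
  refine (hC Δ (h Δ) (β i) _ _ _ hΔ.1 hΔ.2 hlevel_nonneg (hrate Δ hΔ) hdrift hdiff
    (hstab.bound_norm _ i)).trans ?_
  gcongr
  exact enorm_map_trunc_le _ _ _

theorem exists_lintegral_scheme_le [IsProbabilityMeasure P] (hB : IsBrownianMotion P B)
    (hr : IsMarkovChain P Γ ℓ r) (hindep : IndepFun (fun ω t => B t ω) (fun ω t => r t ω) P)
    (hφ : IsLipschitzControl f g φ) {R : Matrix (Fin n) (Fin n) ℝ} (hR : IsUnit R)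
    {p κ Δ : ℝ} (hp : 0 < p) (hΔ : 0 < Δ) {a ζ : Fin m → ℝ} (ha : ∀ i, 0 ≤ a i)
    (hstep : ∀ i x, ∫⁻ b, ‖R.toEuclideanLin (truncStep f g φ (h Δ) Δ i x b)‖ₑ ^ p
        ∂(stdGaussian (EuclideanSpace ℝ (Fin d))).map (√Δ • ·)
      ≤ ENNReal.ofReal (a i) * ‖R.toEuclideanLin x‖ₑ ^ p)
    (hκ : 0 ≤ κ) (hζ_pos : ∀ i, 0 < ζ i)
    (hζ : ∀ i, a i * (NormedSpace.exp (Δ • Γ) *ᵥ ζ) i ≤ ζ i * κ) (x₀ : EuclideanSpace ℝ (Fin n)) :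
    ∃ A : ℝ≥0∞, A ≠ ⊤ ∧ ∀ k, ∫⁻ ω, ‖scheme f g φ h x₀ r B Δ k ω‖ₑ ^ p ∂P
      ≤ A * ENNReal.ofReal κ ^ k := by
  have hΔ_coe : (Δ.toNNReal : ℝ) = Δ := Real.coe_toNNReal Δ hΔ.le
  obtain ⟨D, hD, hprod⟩ := hr.exists_lintegral_prod_le Δ.toNNReal ha hκ hζ_pos
    (by rwa [hΔ_coe])
  have hindep' : IndepFun (fun ω (j : ℕ) => r (j * Δ.toNNReal) ω)
      (fun ω j => increment B Δ.toNNReal j ω) P := by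
    have hinc : Measurable fun (y : ℝ≥0 → EuclideanSpace ℝ (Fin d)) (j : ℕ) =>
        y ((j + 1) * Δ.toNNReal) - y (j * Δ.toNNReal) := by fun_prop
    have hgrid : Measurable fun (y : ℝ≥0 → Fin m) (j : ℕ) => y (j * Δ.toNNReal) := by fun_prop
    exact (hindep.comp hinc hgrid).symm
  have horbit (k : ℕ) := lintegral_drivenOrbit_le_of_indepFun
    (V := fun x => ‖R.toEuclideanLin x‖ₑ ^ p) (hφ.measurable_truncStep (h Δ) Δ)
    (hB.measurable_increment Δ.toNNReal) (hB.iIndepFun_increment _)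
    (fun k => by rw [hB.map_increment, hΔ_coe])
    ((LinearMap.continuous_of_finiteDimensional R.toEuclideanLin).measurable.enorm.pow_const p)
    hstep (fun k => hr.measurable _) hindep' x₀ k
  have hnorm (x : EuclideanSpace ℝ (Fin n)) :
      ‖x‖ₑ ≤ ENNReal.ofReal (traceNorm R⁻¹) * ‖R.toEuclideanLin x‖ₑ := by
    rw [← ofReal_norm, ← ofReal_norm, ← ENNReal.ofReal_mul (traceNorm_nonneg _)]
    exact ENNReal.ofReal_le_ofReal (norm_le_traceNorm_inv_mul hR x)
  refine ⟨ENNReal.ofReal (traceNorm R⁻¹) ^ p * (D * ‖R.toEuclideanLin x₀‖ₑ ^ p),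
    by finiteness, fun k => ?_⟩
  calc ∫⁻ ω, ‖scheme f g φ h x₀ r B Δ k ω‖ₑ ^ p ∂P
      ≤ ∫⁻ ω, ENNReal.ofReal (traceNorm R⁻¹) ^ p * ‖R.toEuclideanLin
          (drivenOrbit (truncStep f g φ (h Δ) Δ) x₀ (fun j => r (j * Δ.toNNReal) ω)
            (fun j => increment B Δ.toNNReal j ω) k)‖ₑ ^ p ∂P := by
        gcongr with ω
        rw [← ENNReal.mul_rpow_of_nonneg _ _ hp.le, scheme_eq_trunc_drivenOrbit]
        gcongr
        exact (hnorm _).trans (by gcongr; exact enorm_map_trunc_le _ _ _)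
    _ ≤ ENNReal.ofReal (traceNorm R⁻¹) ^ p
          * (D * ENNReal.ofReal κ ^ k * ‖R.toEuclideanLin x₀‖ₑ ^ p) := by
        rw [lintegral_const_mul' _ _ (by finiteness)]
        gcongr
        exact (horbit k).trans (by gcongr; exact hprod k)
    _ = _ := by ring

end Scheme

end SwitchingEM

end

theorem corollary4p9_general {n d m : ℕ} {Ω : Type*} [MeasurableSpace Ω]
    {P : Measure Ω} [IsProbabilityMeasure P]
    {B : ℝ≥0 → Ω → EuclideanSpace ℝ (Fin d)} (hB : IsBrownianMotion P B)
    {Γ : Matrix (Fin m) (Fin m) ℝ} (hΓ : IsGenerator Γ)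
    {ℓ : Fin m} {r : ℝ≥0 → Ω → Fin m} (hr : IsMarkovChain P Γ ℓ r)
    (hindep : IndepFun (fun ω t => B t ω) (fun ω t => r t ω) P)
    {x₀ : EuclideanSpace ℝ (Fin n)}
    {f : EuclideanSpace ℝ (Fin n) → Fin m → EuclideanSpace ℝ (Fin n)}
    {g : EuclideanSpace ℝ (Fin n) → Fin m → Matrix (Fin n) (Fin d) ℝ}
    {Q : Matrix (Fin n) (Fin n) ℝ} {β : Fin m → ℝ} {ρ : ℝ}
    (hstab : StabilityAssumption f g Q β ρ)
    {φ : Fin m → ℝ → ℝ} (hφ : IsLipschitzControl f g φ)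
    {h : ℝ → ℝ} (hh : IsTruncationLevel f g φ x₀ h)
    {p : ℝ} (hp : 0 < p) (hp_le : p ≤ ρ) {κ : ℝ} (hκ : κ < eta Γ p β) :
    ∃ Δs : ℝ, 0 < Δs ∧ Δs ≤ 1 ∧ ∀ Δ : ℝ, 0 < Δ → Δ ≤ Δs →
      limsup (fun k : ℕ =>
          ENNReal.log (∫⁻ ω, ‖scheme f g φ h x₀ r B Δ k ω‖ₑ ^ p ∂P) / ((k * Δ : ℝ) : EReal)) atTop
            ≤ ((-κ : ℝ) : EReal) ∧
      ∀ᵐ ω ∂P, limsup (fun k : ℕ =>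
          ENNReal.log ‖scheme f g φ h x₀ r B Δ k ω‖ₑ / ((k * Δ : ℝ) : EReal)) atTop
            ≤ ((-(κ / p) : ℝ) : EReal) := by
  obtain ⟨κ', hκκ', hκ'⟩ := exists_between hκ
  obtain ⟨R, hR, rfl⟩ := exists_isUnit_eq_transpose_mul_self hstab.Q_posDef
  obtain ⟨C, θ, hθ, hstep⟩ := exists_lintegral_truncStep_le hR hstab hφ hh hp hp_le
  obtain ⟨ζ, hζ_pos, hζ⟩ := exists_eventually_exp_mul_exp_smul_mulVec_le hΓ.nonneg hκ'
  obtain ⟨δ, hδ, hζδ⟩ := mem_nhdsGT_iff_exists_Ioc_subset.1 (hζ C (by linarith : 1 < 1 + 2 * θ))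
  refine ⟨min δ 1, lt_min hδ one_pos, min_le_right _ _, fun Δ hΔ hΔs => ?_⟩
  obtain ⟨hΔδ, hΔ_le_one⟩ := le_min_iff.1 hΔs
  obtain ⟨A, hA, hmoment⟩ := exists_lintegral_scheme_le hB hr hindep hφ hR hp hΔ
    (fun _ => (Real.exp_pos _).le) (hstep Δ ⟨hΔ, hΔ_le_one⟩) (Real.exp_pos _).le hζ_pos
    (hζδ ⟨hΔ, hΔδ⟩) x₀
  have hsum := tsum_ofReal_exp_mul_ne_top hA hΔ hκκ' hmoment
  exact ⟨limsup_log_div_le hΔ (ENNReal.tendsto_atTop_zero_of_tsum_ne_top hsum),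
    ae_limsup_log_div_le (fun k => (measurable_scheme hB hφ hr.measurable h x₀ Δ k).enorm)
      hΔ hp hsum⟩

/-- Logarithms are taken in `[-∞, ∞]`, with `log 0 = -∞`. -/
theorem corollary4p9 {n d m : ℕ} {Ω : Type*} [MeasurableSpace Ω]
    (P : Measure Ω) [IsProbabilityMeasure P]
    (B : ℝ≥0 → Ω → EuclideanSpace ℝ (Fin d)) (hB : IsBrownianMotion P B)
    (Γ : Matrix (Fin m) (Fin m) ℝ) (hΓ : IsGenerator Γ) (hirr : IsIrreducibleGenerator Γ)
    (ℓ : Fin m) (r : ℝ≥0 → Ω → Fin m) (hr : IsMarkovChain P Γ ℓ r)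
    (hindep : IndepFun (fun ω t => B t ω) (fun ω t => r t ω) P)
    (x₀ : EuclideanSpace ℝ (Fin n))
    (f : EuclideanSpace ℝ (Fin n) → Fin m → EuclideanSpace ℝ (Fin n))
    (g : EuclideanSpace ℝ (Fin n) → Fin m → Matrix (Fin n) (Fin d) ℝ)
    (hfg : IsLocallyLipschitz f g)
    (Q : Matrix (Fin n) (Fin n) ℝ) (β : Fin m → ℝ) (ρ : ℝ)
    (hstab : StabilityAssumption f g Q β ρ)
    (π : Fin m → ℝ) (hπ : IsStationaryVector Γ π) (hπβ : ∑ i, π i * β i < 0)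
    (pstar : EReal) (hpstar : IsCriticalExponent Γ β pstar)
    (φ : Fin m → ℝ → ℝ) (hφ : IsLipschitzControl f g φ)
    (h : ℝ → ℝ) (hh : IsTruncationLevel f g φ x₀ h)
    (p : ℝ) (hp : 0 < p) (hp_lt : (p : EReal) < pstar) (hp_le : p ≤ ρ)
    (ϱ : ℝ) (hϱ : 0 < ϱ) (hϱ_lt : ϱ < eta Γ p β) :
    ∃ Δs : ℝ, 0 < Δs ∧ Δs ≤ 1 ∧ ∀ Δ : ℝ, 0 < Δ → Δ ≤ Δs →
      (limsup (fun k : ℕ =>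
          ENNReal.log (∫⁻ ω, ‖scheme f g φ h x₀ r B Δ k ω‖ₑ ^ p ∂P) / ((k * Δ : ℝ) : EReal)) atTop
            ≤ ((-(eta Γ p β - ϱ) : ℝ) : EReal) ∧
        -(eta Γ p β - ϱ) < 0) ∧
      ∀ᵐ ω ∂P, limsup (fun k : ℕ =>
          ENNReal.log ‖scheme f g φ h x₀ r B Δ k ω‖ₑ / ((k * Δ : ℝ) : EReal)) atTop
            ≤ ((-((eta Γ p β - ϱ) / p) : ℝ) : EReal) := by
  obtain ⟨Δs, hΔs_pos, hΔs_le, hrates⟩ := corollary4p9_general hB hΓ hr hindep hstab hφ hh hp hp_le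
    (sub_lt_self (eta Γ p β) hϱ)
  exact ⟨Δs, hΔs_pos, hΔs_le, fun Δ hΔ hΔ_le =>
    ⟨⟨(hrates Δ hΔ hΔ_le).1, neg_neg_of_pos (sub_pos.2 hϱ_lt)⟩, (hrates Δ hΔ hΔ_le).2⟩⟩
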